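/- Let $(L|K,v)$ be a finite extension of valued fields (that is, $L|K$ is a finite field extension, $v$ is a valuation on $L$, and every subfield of $L$ carries the restriction of $v$) which is unibranched, i.e. up to equivalence $v$ is the only extension to $L$ of its restriction to $K$. For a field $F$ with $K\subseteq F\subseteq L$ denote by $\mathcal{O}_F$ the valuation ring and by $Fv$ the residue field of $(F,v)$. Suppose that there is a tower of fields $K=K_0\subseteq K_1\subseteq\cdots\subseteq K_\ell=L$ such that for each $1\le i\le \ell$ at least one of the following holds: 1) $K_i|K_{i-1}$ is Galois of prime degree; or 2) $[K_i:K_{i-1}]=[K_iv:K_{i-1}v]$ and $K_iv|K_{i-1}v$ is separable. Then for every $1\le i\le \ell$ the natural sequence of $\mathcal{O}_{K_i}$-modules of Kähler differentials $$0\longrightarrow \Omega_{\mathcal{O}_{K_{i-1}}|\mathcal{O}_K}\otimes_{\mathcal{O}_{K_{i-1}}}\mathcal{O}_{K_i}\longrightarrow \Omega_{\mathcal{O}_{K_i}|\mathcal{O}_K}\longrightarrow \Omega_{\mathcal{O}_{K_i}|\mathcal{O}_{K_{i-1}}}\longrightarrow 0$$ is exact. -/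

import Mathlib

universe u v w

namespace ValTower

/-- `(L|K, ν)` is unibranched: every valuation on `L` that restricts on `K` to a valuation
equivalent to the restriction of `ν` is equivalent to `ν`.  Up to equivalence, every valuation of
`L` takes its values in a group (with zero) living in the universe of `L`, namely
`L` modulo the units of its valuation ring. -/
def IsUnibranched (K : Type u) {L : Type v} {Γ : Type w} [Field K] [Field L] [Algebra K L]
    [LinearOrderedCommGroupWithZero Γ] (ν : Valuation L Γ) : Prop :=
  ∀ (Δ : Type v) [LinearOrderedCommGroupWithZero Δ] (μ : Valuation L Δ),
    (μ.comap (algebraMap K L)).IsEquiv (ν.comap (algebraMap K L)) → μ.IsEquiv ν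

section

variable {L : Type v} {Γ : Type w} [Field L] [LinearOrderedCommGroupWithZero Γ]

/-- The valuation ring `𝒪_F` of a subfield `F → L`, with respect to the restriction of `ν`. -/
def valRing (ν : Valuation L Γ) (F : Type*) [Field F] [Algebra F L] : ValuationSubring F :=
  (ν.comap (algebraMap F L)).valuationSubring

/-- The residue field `Fν` of a subfield `F → L`, with respect to the restriction of `ν`. -/
abbrev resField (ν : Valuation L Γ) (F : Type*) [Field F] [Algebra F L] : Type _ :=
  IsLocalRing.ResidueField (valRing ν F)

variable (ν : Valuation L Γ) (F E : Type*) [Field F] [Field E] [Algebra F L] [Algebra E L]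
  [Algebra F E] [IsScalarTower F E L]

theorem mem_valRing (x : F) : x ∈ valRing ν F ↔ ν (algebraMap F L x) ≤ 1 := Iff.rfl

theorem algebraMap_mem_valRing_iff (x : F) :
    algebraMap F E x ∈ valRing ν E ↔ x ∈ valRing ν F := by
  rw [mem_valRing, mem_valRing, ← IsScalarTower.algebraMap_apply F E L]

/-- The inclusion `𝒪_F → 𝒪_E` for a tower of fields `F ⊆ E ⊆ L`. -/
def valRingMap : valRing ν F →+* valRing ν E :=
  ((algebraMap F E).comp (valRing ν F).subtype).codRestrict (valRing ν E).toSubring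
    fun x => (algebraMap_mem_valRing_iff ν F E x.1).2 x.2

instance valRingAlgebra : Algebra (valRing ν F) (valRing ν E) :=
  (valRingMap ν F E).toAlgebra

theorem coe_algebraMap_valRing (x : valRing ν F) :
    (algebraMap (valRing ν F) (valRing ν E) x : E) = algebraMap F E (x : F) := rfl

instance valRing_isLocalHom : IsLocalHom (algebraMap (valRing ν F) (valRing ν E)) where
  map_nonunit x hx := by
    obtain ⟨y, hy⟩ := isUnit_iff_exists_inv.1 hx
    have hxy : algebraMap F E (x : F) * (y : E) = 1 := congrArg Subtype.val hy
    have hinv : (x : F)⁻¹ ∈ valRing ν F := by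
      rw [← algebraMap_mem_valRing_iff ν F E, map_inv₀, inv_eq_of_mul_eq_one_right hxy]
      exact y.2
    have hx0 : (x : F) ≠ 0 := by
      rintro h
      rw [h, map_zero, zero_mul] at hxy
      exact zero_ne_one hxy
    exact isUnit_iff_exists_inv.2 ⟨⟨_, hinv⟩, Subtype.ext (mul_inv_cancel₀ hx0)⟩

instance valRing_isScalarTower (D : Type*) [Field D] [Algebra D L] [Algebra D F] [Algebra D E]
    [IsScalarTower D F L] [IsScalarTower D E L] [IsScalarTower D F E] :
    IsScalarTower (valRing ν D) (valRing ν F) (valRing ν E) :=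
  IsScalarTower.of_algebraMap_eq fun x =>
    Subtype.ext (IsScalarTower.algebraMap_apply D F E (x : D))

/-- `E|F` is Galois of prime degree. -/
def IsGaloisOfPrimeDegree (F E : Type*) [Field F] [Field E] [Algebra F E] : Prop :=
  IsGalois F E ∧ (Module.finrank F E).Prime

/-- `[E : F] = [Eν : Fν]`, and the residue field extension `Eν|Fν` is separable.
(When `E|F` is finite, `[E : F]` is positive, so the equality forces `Eν|Fν` to be finite.) -/
def IsInertialStep : Prop :=
  Module.finrank F E = Module.finrank (resField ν F) (resField ν E) ∧
    Algebra.IsSeparable (resField ν F) (resField ν E)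

/-- For a tower of fields `D ⊆ F ⊆ E ⊆ L`, the sequence with the natural maps
`0 → 𝒪_E ⊗ Ω(𝒪_F|𝒪_D) → Ω(𝒪_E|𝒪_D) → Ω(𝒪_E|𝒪_F) → 0` is exact. -/
def KaehlerShortExact (D : Type*) [Field D] [Algebra D L] [Algebra D F] [Algebra D E]
    [IsScalarTower D F L] [IsScalarTower D E L] [IsScalarTower D F E] : Prop :=
  Function.Injective
      (KaehlerDifferential.mapBaseChange (valRing ν D) (valRing ν F) (valRing ν E)) ∧
    Function.Exact
      (KaehlerDifferential.mapBaseChange (valRing ν D) (valRing ν F) (valRing ν E))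
      (KaehlerDifferential.map (valRing ν D) (valRing ν F) (valRing ν E) (valRing ν E)) ∧
    Function.Surjective
      (KaehlerDifferential.map (valRing ν D) (valRing ν F) (valRing ν E) (valRing ν E))

end

instance extendScalars_isScalarTower {K L : Type*} [Field K] [Field L] [Algebra K L]
    {F E : IntermediateField K L} (h : F ≤ E) :
    IsScalarTower K (IntermediateField.extendScalars h) L :=
  IsScalarTower.of_algebraMap_eq fun _ => rfl

end ValTower

/-! By the Jacobi–Zariski sequence, the kernel of `Ω(A|R) ⊗ B → Ω(B|R)` is the image of the first
cotangent homology `H₁` of `B` over `A`, and the rest of the exactness is formal. So it is enough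
that `H₁ = 0` for each single step `A = 𝒪_F`, `B = 𝒪_E`.

For a monogenic algebra `A[b] = A[X]/(f)` in a domain, the cotangent complex sends the class of `f`
to `f'(b) dX`, which is injective when `f'(b) ≠ 0`. The same argument works if every finite subset
of `B` lies in such an algebra (`Algebra.subsingleton_h1Cotangent_of_monogenic`). Here `f` is the
minimal polynomial of `b`, integral because conjugates have equal value, and `f'(b) ≠ 0` by
separability.

It remains to exhaust `𝒪_E` by algebras `𝒪_F[b]`. In an inertial step one lift `a` of a primitive
element of the residue extension gives `𝒪_E = 𝒪_F[a]`. In a Galois step of prime degree `q` the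
valuation is Galois invariant, and there are three cases. If a value is new, powers of an element
with new value lie in distinct cosets, so expansions in it can be read off termwise. If a residue is
new, it has degree `q`, and one generator suffices. Otherwise every `a` outside `F` has elements of
`F` ever closer to it, and one uses the elements `(a - c)/d` normalised to value `1`. This works
since, for `c` close to `a`, the constant term dominates the Taylor expansion at `c` of any
polynomial of degree less than `q` (`exists_taylor_lt`). A failure would be a Newton approximation
converging too well, which `not_isRoot_approx` excludes by coarsening the valuation until the
residue of `a` becomes new. -/

/-! ### Cotangent homology of unions of monogenic algebras -/

open Polynomial in
-- Writing `u = f w`, the derivative at `b` is `f'(b) w(b)`, so `w` vanishes at `b` too. This is the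
-- injectivity of `(f)/(f²) → B dX`.
theorem Polynomial.dvd_of_sq {A B : Type*} [CommRing A] [CommRing B] [IsDomain B] [Algebra A B]
    {b : B} {f : A[X]} (hf0 : aeval b f = 0) (hf1 : aeval b (derivative f) ≠ 0)
    (hf : ∀ u : A[X], aeval b u = 0 → f ∣ u) {u : A[X]} (hu0 : aeval b u = 0)
    (hu1 : aeval b (derivative u) = 0) : f * f ∣ u := by
  obtain ⟨w, rfl⟩ := hf u hu0
  rw [derivative_mul, map_add, map_mul, map_mul, hf0, zero_mul, add_zero] at hu1
  exact mul_dvd_mul_left f (hf w ((mul_eq_zero.1 hu1).resolve_left hf1))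

/-- A criterion for the vanishing of the first homology of the cotangent complex: every element
of the kernel of the tautological presentation can be moved, by an endomorphism of the
presentation, into the square of the kernel, as soon as its differential vanishes. -/
theorem Algebra.subsingleton_h1Cotangent_of_hom {A B : Type*} [CommRing A] [CommRing B]
    [Algebra A B]
    (h : ∀ i : MvPolynomial B A, MvPolynomial.aeval (R := A) (_root_.id : B → B) i = 0 →
      ∃ t : B → MvPolynomial B A,
        (∀ y, MvPolynomial.aeval (R := A) (_root_.id : B → B) (t y) = y) ∧
        ((∀ y, MvPolynomial.aeval (R := A) (_root_.id : B → B)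
            (MvPolynomial.pderiv y (MvPolynomial.aeval (R := A) t i)) = 0) →
          MvPolynomial.aeval (R := A) t i ∈
            RingHom.ker (MvPolynomial.aeval (R := A) (_root_.id : B → B)) ^ 2)) :
    Subsingleton (Algebra.H1Cotangent A B) := by
  refine subsingleton_of_forall_eq 0 fun x => ?_
  let P := Generators.self A B
  change P.toExtension.H1Cotangent at x
  have hP : P.toExtension.ker =
      RingHom.ker (MvPolynomial.aeval (R := A) (_root_.id : B → B)) :=
    Generators.ker_eq_ker_aeval_val P
  obtain ⟨i, hi⟩ := Extension.Cotangent.mk_surjective x.1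
  obtain ⟨t, ht, hsq⟩ := h i.1 (hP.le i.2)
  let g : Generators.Hom P P := ⟨t, ht⟩
  have hgi : MvPolynomial.aeval (R := A) t i.1 ∈ P.toExtension.ker := by
    refine hP.ge ?_
    have h1 := g.algebraMap_toAlgHom i.1
    rw [show MvPolynomial.aeval P.val i.1 = 0 from hP.le i.2, map_zero] at h1
    exact h1
  have hmk : Extension.Cotangent.mk (P := P.toExtension)
      ⟨MvPolynomial.aeval (R := A) t i.1, hgi⟩ = x.1 := by
    -- Any two maps of presentations induce the same map on `H₁`, so an endomorphism acts as the
    -- identity.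
    have h1 : Extension.H1Cotangent.map g.toExtensionHom x = x := by
      rw [Extension.H1Cotangent.map_eq g.toExtensionHom (.id P.toExtension),
        Extension.H1Cotangent.map_id, LinearMap.id_apply]
    have h2 : Extension.Cotangent.map g.toExtensionHom x.1 = x.1 := congrArg Subtype.val h1
    rw [← hi, Extension.Cotangent.map_mk] at h2
    exact h2.trans hi
  have hx : P.toExtension.cotangentComplex x.1 = 0 := x.2
  refine Extension.h1Cotangentι_ext _ _ ?_
  rw [← hmk, Extension.H1Cotangent.val_zero, Extension.Cotangent.mk_eq_zero_iff]
  have hP2 : RingHom.ker (MvPolynomial.aeval (R := A) (_root_.id : B → B)) ^ 2 ≤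
      P.toExtension.ker ^ 2 := (congrArg (fun J => J ^ 2) hP).ge
  refine hP2 (hsq fun y => ?_)
  rw [← hmk, Extension.cotangentComplex_mk] at hx
  have h1 := DFunLike.congr_fun (congrArg P.cotangentSpaceBasis.repr hx) y
  erw [Generators.cotangentSpaceBasis_repr_one_tmul] at h1
  rw [map_zero] at h1
  exact h1

open Polynomial in
/-- If every finite subset of a domain `B` lies in a monogenic subalgebra `A[b] = A[X]/(f)` with
`f'(b) ≠ 0`, then the first homology of the cotangent complex of `B` over `A` vanishes. -/
theorem Algebra.subsingleton_h1Cotangent_of_monogenic {A B : Type*} [CommRing A]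
    [CommRing B] [IsDomain B] [Algebra A B]
    (h : ∀ s : Finset B, ∃ b : B, (∀ y ∈ s, ∃ g : A[X], aeval b g = y) ∧
      ∃ f : A[X], aeval b f = 0 ∧ aeval b (derivative f) ≠ 0 ∧
        ∀ u : A[X], aeval b u = 0 → f ∣ u) :
    Subsingleton (Algebra.H1Cotangent A B) := by
  classical
  refine subsingleton_h1Cotangent_of_hom fun i hi => ?_
  obtain ⟨b, hb, f, hf0, hf1, hf⟩ := h i.vars
  choose! c hc using hb
  -- The variables of `i` become polynomials in the single variable `X b`; the others stay put, so
  -- `t` still lifts the identity of `B`.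
  let t : B → MvPolynomial B A := fun y =>
    if y ∈ i.vars then aeval (MvPolynomial.X b) (c y) else MvPolynomial.X y
  have ht : ∀ y, MvPolynomial.aeval (R := A) (_root_.id : B → B) (t y) = y := by
    intro y
    simp only [t]
    split_ifs with hy
    · rw [← aeval_algHom_apply, MvPolynomial.aeval_X]
      exact hc y hy
    · simp
  have hti : MvPolynomial.aeval t i =
      aeval (MvPolynomial.X b : MvPolynomial B A) (MvPolynomial.aeval (R := A) c i) := by
    have h1 : (aeval (MvPolynomial.X b : MvPolynomial B A)) (MvPolynomial.aeval (R := A) c i) =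
        MvPolynomial.aeval (fun y => aeval (MvPolynomial.X b : MvPolynomial B A) (c y)) i := by
      rw [← AlgHom.comp_apply, MvPolynomial.comp_aeval]
    rw [h1]
    refine MvPolynomial.eval₂Hom_congr' rfl (fun y hy _ => ?_) rfl
    simp only [t, if_pos hy]
  have hX : ∀ u : A[X], MvPolynomial.aeval (R := A) (_root_.id : B → B)
      (aeval (MvPolynomial.X b : MvPolynomial B A) u) = aeval b u := by
    intro u
    rw [← aeval_algHom_apply, MvPolynomial.aeval_X, _root_.id]
  refine ⟨t, ht, fun hd => ?_⟩
  have hu0 : aeval b (MvPolynomial.aeval (R := A) c i) = 0 := by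
    rw [← hX, ← hti, ← AlgHom.comp_apply, MvPolynomial.comp_aeval, ← hi]
    simp only [ht]
    rfl
  have hu1 : aeval b (derivative (MvPolynomial.aeval (R := A) c i)) = 0 := by
    have h1 := hd b
    rwa [hti, Derivation.map_aeval, MvPolynomial.pderiv_X_self, smul_eq_mul, mul_one, hX] at h1
  obtain ⟨w, hw⟩ := Polynomial.dvd_of_sq hf0 hf1 hf hu0 hu1
  have hfk : aeval (MvPolynomial.X b : MvPolynomial B A) f ∈
      RingHom.ker (MvPolynomial.aeval (R := A) (_root_.id : B → B)) := by
    rw [RingHom.mem_ker, hX, hf0]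
  rw [hti, hw, map_mul, map_mul, pow_two]
  exact Ideal.mul_mem_right _ _ (Ideal.mul_mem_mul hfk hfk)

theorem KaehlerDifferential.mapBaseChange_injective_of_subsingleton_h1Cotangent
    (R A B : Type*) [CommRing R] [CommRing A] [CommRing B] [Algebra R A] [Algebra R B]
    [Algebra A B] [IsScalarTower R A B] [Subsingleton (Algebra.H1Cotangent A B)] :
    Function.Injective (KaehlerDifferential.mapBaseChange R A B) := by
  rw [injective_iff_map_eq_zero]
  intro x hx
  obtain ⟨y, rfl⟩ := (Algebra.H1Cotangent.exact_δ_mapBaseChange R A B x).1 hx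
  rw [Subsingleton.elim y 0, map_zero]

/-! ### Prime degree, directed exhaustion and values of polynomials -/

section

open Polynomial

namespace ValTower

section PrimeDegree

variable {F E : Type*} [Field F] [Field E] [Algebra F E]

theorem natDegree_minpoly_of_finrank_prime [FiniteDimensional F E]
    (hq : (Module.finrank F E).Prime) {a : E} (ha : a ∉ Set.range (algebraMap F E)) :
    (minpoly F a).natDegree = Module.finrank F E :=
  ((Nat.dvd_prime hq).1 (minpoly.degree_dvd (K := F) (Algebra.IsIntegral.isIntegral a))).resolve_left
    fun h => ha (minpoly.natDegree_eq_one_iff.1 h)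

theorem exists_aeval_eq_of_natDegree_minpoly [FiniteDimensional F E] {a : E}
    (ha : (minpoly F a).natDegree = Module.finrank F E) (y : E) :
    ∃ g : F[X], g.natDegree < Module.finrank F E ∧ aeval a g = y := by
  have hint : IsIntegral F a := Algebra.IsIntegral.isIntegral a
  have hy : y ∈ (IntermediateField.adjoin F {a}).toSubalgebra := by
    rw [(Field.primitive_element_iff_minpoly_natDegree_eq F a).2 ha]
    trivial
  rw [IntermediateField.adjoin_simple_toSubalgebra_of_isAlgebraic hint.isAlgebraic,
    Algebra.adjoin_singleton_eq_range_aeval] at hy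
  obtain ⟨g, rfl⟩ := hy
  refine ⟨g %ₘ minpoly F a, ?_, aeval_modByMonic_eq_self_of_root (minpoly.aeval F a)⟩
  rw [← ha]
  refine natDegree_modByMonic_lt g (minpoly.monic hint) fun h => ?_
  rw [h, natDegree_one] at ha
  exact Module.finrank_pos.ne ha

theorem exists_aeval_eq_of_finrank_prime [FiniteDimensional F E]
    (hq : (Module.finrank F E).Prime) {a : E} (ha : a ∉ Set.range (algebraMap F E)) (y : E) :
    ∃ g : F[X], g.natDegree < Module.finrank F E ∧ aeval a g = y :=
  exists_aeval_eq_of_natDegree_minpoly (natDegree_minpoly_of_finrank_prime hq ha) y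

theorem aeval_ne_zero_of_finrank_prime [FiniteDimensional F E]
    (hq : (Module.finrank F E).Prime) {a : E} (ha : a ∉ Set.range (algebraMap F E)) {g : F[X]}
    (hg : g.natDegree < Module.finrank F E) (hg0 : g ≠ 0) : aeval a g ≠ 0 := fun h => by
  have h1 := natDegree_le_of_dvd (minpoly.dvd F a h) hg0
  rw [natDegree_minpoly_of_finrank_prime hq ha] at h1
  omega

end PrimeDegree

section Valued

variable {F E Γ : Type*} [Field F] [Field E] [Algebra F E] [LinearOrderedCommGroupWithZero Γ]
  (v : Valuation E Γ)

variable (F) in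
/-- `y` is a polynomial in `b` with coefficients in the valuation ring of `F`. -/
def IsIntegralPolynomialIn (b y : E) : Prop :=
  ∃ g : F[X], (∀ i, v (algebraMap F E (g.coeff i)) ≤ 1) ∧ aeval b g = y

variable (F) in
/-- Every finite subset of the valuation ring of `E` is contained in a monogenic algebra over the
valuation ring of `F`. -/
def IsExhaustedByMonogenic : Prop :=
  ∀ s : Finset E, (∀ y ∈ s, v y ≤ 1) →
    ∃ b : E, v b ≤ 1 ∧ ∀ y ∈ s, IsIntegralPolynomialIn F v b y

/-- A linearly directed family of monogenic algebras exhausting the valuation ring one element at a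
time exhausts it. -/
theorem IsExhaustedByMonogenic.of_family {ι : Type*} [Nonempty ι] {Λ : Type*} [LinearOrder Λ]
    (r : ι → Λ) (b : ι → E) (hb : ∀ i, v (b i) ≤ 1)
    (h : ∀ y, v y ≤ 1 → ∃ i, ∀ j, r i ≤ r j → IsIntegralPolynomialIn F v (b j) y) :
    IsExhaustedByMonogenic F v := by
  classical
  suffices H : ∀ s : Finset E, (∀ y ∈ s, v y ≤ 1) →
      ∃ i, ∀ j, r i ≤ r j → ∀ y ∈ s, IsIntegralPolynomialIn F v (b j) y by
    intro s hs
    obtain ⟨i, hi⟩ := H s hs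
    exact ⟨b i, hb i, hi i le_rfl⟩
  intro s
  induction s using Finset.induction_on with
  | empty => exact fun _ => ⟨Classical.arbitrary ι, by simp⟩
  | insert y s _ ih =>
    intro hs
    obtain ⟨i, hi⟩ := ih fun z hz => hs z (Finset.mem_insert_of_mem hz)
    obtain ⟨k, hk⟩ := h y (hs y (Finset.mem_insert_self y s))
    rcases le_total (r i) (r k) with hik | hik
    · refine ⟨k, fun j hj z hz => ?_⟩
      rcases Finset.mem_insert.1 hz with rfl | hz
      · exact hk j hj
      · exact hi j (hik.trans hj) z hz
    · refine ⟨i, fun j hj z hz => ?_⟩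
      rcases Finset.mem_insert.1 hz with rfl | hz
      · exact hk j (hik.trans hj)
      · exact hi j hj z hz

/-- The norm is the product of the conjugates, which all have the same value. -/
theorem val_pow_eq_val_norm [FiniteDimensional F E] [IsGalois F E]
    (hv : ∀ (σ : E ≃ₐ[F] E) (x : E), v (σ x) = v x) (x : E) :
    v x ^ Module.finrank F E = v (algebraMap F E (Algebra.norm F x)) := by
  classical
  rw [Algebra.norm_eq_prod_automorphisms, map_prod, Finset.prod_congr rfl fun σ _ => hv σ x,
    Finset.prod_const, Finset.card_univ, ← IsGalois.card_aut_eq_finrank F E, Nat.card_eq_fintype_card]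

/-- By Bézout, `v x` is a product of powers of `v x ^ i` and `v x ^ q`, so it would be a value of
`F` if both were. -/
theorem val_pow_ne_of_coprime {x : E} {q i : ℕ} (hx : ∀ c : F, v x ≠ v (algebraMap F E c)) {n : F}
    (hn : v x ^ q = v (algebraMap F E n)) (hi : i.Coprime q) (c : F) :
    v x ^ i ≠ v (algebraMap F E c) := by
  intro h
  have hx0 : v x ≠ 0 := by simpa using hx 0
  apply hx (c ^ Nat.gcdA i q * n ^ Nat.gcdB i q)
  have h1 := Nat.gcd_eq_gcd_ab i q
  rw [hi.gcd_eq_one, Nat.cast_one] at h1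
  rw [map_mul, map_mul, map_zpow₀, map_zpow₀, map_zpow₀, map_zpow₀, ← h, ← hn, ← zpow_natCast,
    ← zpow_natCast, ← zpow_mul, ← zpow_mul, ← zpow_add₀ hx0, ← h1, zpow_one]

/-- If the powers `x ^ i` for `i < q` have values in distinct cosets of the value group of `F`, the
value of a polynomial of degree `< q` in `x` is the maximum of the values of its terms. -/
theorem exists_val_aeval_eq {x : E} {q : ℕ}
    (hx : ∀ i, 0 < i → i < q → ∀ c : F, v x ^ i ≠ v (algebraMap F E c)) (hx0 : x ≠ 0)
    {g : F[X]} (hg : g.natDegree < q) :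
    ∃ j < q, v (aeval x g) = v (algebraMap F E (g.coeff j)) * v x ^ j ∧
      ∀ i, v (algebraMap F E (g.coeff i)) * v x ^ i ≤ v (aeval x g) := by
  classical
  have hvx : v x ≠ 0 := (Valuation.ne_zero_iff v).2 hx0
  set t : ℕ → Γ := fun i => v (algebraMap F E (g.coeff i)) * v x ^ i with ht
  have htv : ∀ i, t i = v (g.coeff i • x ^ i) := fun i => by
    rw [ht, Algebra.smul_def, map_mul, map_pow]
  obtain ⟨j, hj, hmax⟩ := Finset.exists_max_image (Finset.range q) t
    ⟨0, Finset.mem_range.2 (by omega)⟩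
  rw [Finset.mem_range] at hj
  have hmax' : ∀ i, t i ≤ t j := fun i => by
    by_cases hi : i < q
    · exact hmax i (Finset.mem_range.2 hi)
    · rw [ht]
      simp only
      rw [coeff_eq_zero_of_natDegree_lt (by omega : g.natDegree < i)]
      simp
  suffices hval : v (aeval x g) = t j from ⟨j, hj, hval, fun i => hval ▸ hmax' i⟩
  rw [aeval_eq_sum_range' hg]
  by_cases h0 : t j = 0
  · rw [h0]
    refine le_antisymm (v.map_sum_le fun i _ => ?_) zero_le
    rw [← htv, ← h0]
    exact hmax' i
  · rw [htv]
    refine v.map_sum_eq_of_lt (Finset.mem_range.2 hj) fun i hi => ?_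
    rw [← htv, ← htv]
    obtain ⟨hi, hij⟩ := Finset.mem_sdiff.1 hi
    rw [Finset.mem_singleton] at hij
    rw [Finset.mem_range] at hi
    refine (hmax' i).lt_of_ne fun heq => ?_
    -- Two equal nonzero terms would make `v x ^ (l - k)` a value of `F`.
    have key : ∀ k l, k < l → l < q → t k = t l → t l ≠ 0 → False := by
      intro k l hkl hl hkl' hl0
      have hl1 : v (algebraMap F E (g.coeff l)) ≠ 0 := left_ne_zero_of_mul hl0
      refine hx (l - k) (by omega) (by omega) (g.coeff k / g.coeff l) ?_
      rw [map_div₀, map_div₀, eq_div_iff hl1]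
      have h1 : v x ^ l = v x ^ (l - k) * v x ^ k := by rw [← pow_add]; congr 1; omega
      simp only [ht] at hkl'
      rw [h1, ← mul_assoc] at hkl'
      rw [mul_comm]
      exact (mul_right_cancel₀ (pow_ne_zero k hvx) hkl').symm
    rcases lt_or_gt_of_ne hij with hlt | hlt
    · exact key i j hlt hj heq h0
    · exact key j i hlt hi heq.symm (heq ▸ h0)

end Valued

end ValTower

end

/-! ### Ramified Galois steps -/

section

open Polynomial

namespace ValTower

section Ramified

variable {F E Γ : Type*} [Field F] [Field E] [Algebra F E] [LinearOrderedCommGroupWithZero Γ]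
  (v : Valuation E Γ)

variable (F) in
/-- The value of `x` is smaller than `1` and is not the value of an element of `F`. -/
def IsSmallOutside (x : E) : Prop :=
  v x < 1 ∧ ∀ c : F, v x ≠ v (algebraMap F E c)

variable {v}

theorem IsSmallOutside.ne_zero {x : E} (hx : IsSmallOutside F v x) : x ≠ 0 := by
  rintro rfl
  exact hx.2 0 (by simp)

theorem mul_val_ne {z : E} (hz : ∀ c : F, v z ≠ v (algebraMap F E c)) {d : F} (hd : d ≠ 0) (c : F) :
    v (algebraMap F E d * z) ≠ v (algebraMap F E c) := by
  intro h
  have hd' : v (algebraMap F E d) ≠ 0 := by simpa using hd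
  refine hz (c / d) ?_
  rw [map_div₀, map_div₀, ← h, map_mul, mul_div_cancel_left₀ _ hd']

/-- Take for `c` the constant term of the expansion of `y` in powers of `a`; the dominant remaining
term has its value outside that of `F`. -/
theorem exists_sub_isSmallOutside {a : E} {q : ℕ}
    (ha : ∀ i, 0 < i → i < q → ∀ c : F, v a ^ i ≠ v (algebraMap F E c)) (ha0 : a ≠ 0)
    (hgen : ∀ y : E, ∃ g : F[X], g.natDegree < q ∧ aeval a g = y) {y : E} (hy : v y ≤ 1) :
    ∃ c : F, v (algebraMap F E c) ≤ 1 ∧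
      (y - algebraMap F E c = 0 ∨ IsSmallOutside F v (y - algebraMap F E c)) := by
  obtain ⟨g, hg, rfl⟩ := hgen y
  obtain ⟨-, -, -, hle⟩ := exists_val_aeval_eq v ha ha0 hg
  have hc : v (algebraMap F E (g.coeff 0)) ≤ 1 := by
    have := (hle 0).trans hy
    rwa [pow_zero, mul_one] at this
  refine ⟨g.coeff 0, hc, ?_⟩
  by_cases h0 : aeval a g - algebraMap F E (g.coeff 0) = 0
  · exact Or.inl h0
  right
  have hg' : aeval a (g - C (g.coeff 0)) = aeval a g - algebraMap F E (g.coeff 0) := by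
    rw [map_sub, aeval_C]
  obtain ⟨j, hj, hval, -⟩ := exists_val_aeval_eq v ha ha0
    (g := g - C (g.coeff 0)) (by rwa [natDegree_sub_C])
  rw [hg'] at hval
  have hne : v (aeval a g - algebraMap F E (g.coeff 0)) ≠ 0 := (Valuation.ne_zero_iff v).2 h0
  have hcj : (g - C (g.coeff 0)).coeff j ≠ 0 := by
    intro h
    rw [h] at hval
    simp only [map_zero, zero_mul] at hval
    exact hne hval
  have hj0 : 0 < j := by
    rcases Nat.eq_zero_or_pos j with rfl | h
    · simp at hcj
    · exact h
  have hout : ∀ c : F, v (aeval a g - algebraMap F E (g.coeff 0)) ≠ v (algebraMap F E c) := by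
    intro c
    rw [hval, ← map_pow, ← map_mul]
    exact mul_val_ne (by simpa only [map_pow] using ha j hj0 hj) hcj c
  refine ⟨(v.map_sub_le hy hc).lt_of_ne fun h => hout 1 ?_, hout⟩
  rw [h, map_one, map_one]

/-- The ramified case when the values outside the value group of `F` have no smallest scale. -/
theorem IsExhaustedByMonogenic.of_isSmallOutside_dense {a : E} {q : ℕ}
    (ha : IsSmallOutside F v a)
    (hS : ∀ b, IsSmallOutside F v b →
      ∀ i, 0 < i → i < q → ∀ c : F, v b ^ i ≠ v (algebraMap F E c))
    (hgen : ∀ b, IsSmallOutside F v b → ∀ y : E, ∃ g : F[X], g.natDegree < q ∧ aeval b g = y)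
    (hdense : ∀ x, IsSmallOutside F v x → ∃ b, IsSmallOutside F v b ∧ v x ≤ v b ^ 2) :
    IsExhaustedByMonogenic F v := by
  have hdense' : ∀ x, IsSmallOutside F v x → ∀ n : ℕ,
      ∃ b, IsSmallOutside F v b ∧ v x ≤ v b ^ 2 ^ n := by
    intro x hx n
    induction n with
    | zero => exact ⟨x, hx, by simp⟩
    | succ n ih =>
      obtain ⟨b, hb, hxb⟩ := ih
      obtain ⟨d, hd, hbd⟩ := hdense b hb
      refine ⟨d, hd, hxb.trans ?_⟩
      rw [pow_succ', pow_mul]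
      exact pow_le_pow_left₀ zero_le hbd _
  have : Nonempty {b // IsSmallOutside F v b} := ⟨⟨a, ha⟩⟩
  refine IsExhaustedByMonogenic.of_family v (ι := {b // IsSmallOutside F v b})
    (fun b => v b.1) (fun b => b.1) (fun b => b.2.1.le) fun y hy => ?_
  obtain ⟨c, hc, hyc⟩ := exists_sub_isSmallOutside (hS a ha) ha.ne_zero (hgen a ha) hy
  rcases hyc with hyc | hyc
  · refine ⟨⟨a, ha⟩, fun _ _ => ⟨C c, fun i => ?_, ?_⟩⟩
    · rw [coeff_C]
      split_ifs
      · exact hc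
      · simp
    · rw [aeval_C, sub_eq_zero.1 hyc]
  -- Since `2 ^ q` exceeds each exponent `i < q`, the bound `v (y - c) ≤ v b ^ i` will force
  -- integral coefficients.
  obtain ⟨β, hβ, hyβ⟩ := hdense' _ hyc q
  refine ⟨⟨β, hβ⟩, fun b hb => ?_⟩
  obtain ⟨g, hg, hgy⟩ := hgen b.1 b.2 (y - algebraMap F E c)
  obtain ⟨-, -, -, hle⟩ := exists_val_aeval_eq v (hS b.1 b.2) b.2.ne_zero hg
  refine ⟨g + C c, fun i => ?_, by rw [map_add, hgy, aeval_C, sub_add_cancel]⟩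
  have hbpos : 0 < v b.1 := zero_lt_iff.2 ((Valuation.ne_zero_iff v).2 b.2.ne_zero)
  rw [coeff_add, map_add]
  refine v.map_add_le ?_ ?_
  · by_cases hi : i < q
    · have h1 := hle i
      rw [hgy] at h1
      have h2 : v (y - algebraMap F E c) ≤ v b.1 ^ i :=
        hyβ.trans ((pow_le_pow_left₀ zero_le hb _).trans
          (pow_le_pow_of_le_one hbpos.le b.2.1.le (hi.le.trans Nat.lt_two_pow_self.le)))
      have h3 := h1.trans h2
      rwa [mul_le_iff_le_one_left (pow_pos hbpos i)] at h3
    · rw [coeff_eq_zero_of_natDegree_lt (by omega : g.natDegree < i)]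
      simp
  · rw [coeff_C]
    split_ifs
    · exact hc
    · simp

/-- The ramified case when there is a smallest scale for the values outside the value group of
`F`. -/
theorem IsExhaustedByMonogenic.of_isSmallOutside_discrete {a : E} {q : ℕ}
    (ha : IsSmallOutside F v a)
    (haq : ∀ i, 0 < i → i < q → ∀ c : F, v a ^ i ≠ v (algebraMap F E c))
    (hgen : ∀ y : E, ∃ g : F[X], g.natDegree < q ∧ aeval a g = y)
    (hdisc : ∀ b, IsSmallOutside F v b → v b ^ 2 < v a) :
    IsExhaustedByMonogenic F v := by
  have hva : 0 < v a := zero_lt_iff.2 ((Valuation.ne_zero_iff v).2 ha.ne_zero)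
  -- if `c a ^ (i + 1)` is small, so is `c a`
  have hdesc : ∀ i, i + 1 < q → ∀ c : F, c ≠ 0 → v (algebraMap F E c * a ^ (i + 1)) ≤ 1 →
      IsSmallOutside F v (algebraMap F E c * a) := by
    intro i
    induction i with
    | zero =>
      intro _ c hc h
      rw [zero_add, pow_one] at h
      refine ⟨h.lt_of_ne fun h1 => mul_val_ne ha.2 hc 1 ?_, mul_val_ne ha.2 hc⟩
      rw [h1, map_one, map_one]
    | succ i ih =>
      intro hi c hc h
      -- If `c a ^ (i + 1)` had value above `1`, its inverse and `c a ^ (i + 2)` would both be small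
      -- outside elements. Their product is `a`, while the square of each has value below `v a`: a
      -- contradiction.
      refine ih (by omega) c hc (le_of_not_gt fun hgt => ?_)
      have hout : ∀ d : F, v (algebraMap F E c * a ^ (i + 1)) ≠ v (algebraMap F E d) :=
        mul_val_ne (by simpa only [map_pow] using haq (i + 1) (by omega) (by omega)) hc
      have hout' : ∀ d : F, v (algebraMap F E c * a ^ (i + 2)) ≠ v (algebraMap F E d) :=
        mul_val_ne (by simpa only [map_pow] using haq (i + 2) (by omega) (by omega)) hc
      have hz : IsSmallOutside F v (algebraMap F E c * a ^ (i + 2)) :=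
        ⟨h.lt_of_ne fun h1 => hout' 1 (by rw [h1, map_one, map_one]), hout'⟩
      have hw : IsSmallOutside F v (algebraMap F E c * a ^ (i + 1))⁻¹ := by
        refine ⟨?_, fun d hd => hout d⁻¹ ?_⟩
        · rw [map_inv₀]
          exact inv_lt_one_of_one_lt₀ hgt
        · rw [map_inv₀, map_inv₀, ← hd, map_inv₀, inv_inv]
      have h1 := hdisc _ hz
      have h2 := hdisc _ hw
      have hcne : v (algebraMap F E c) ≠ 0 := by simpa using hc
      have h3 : v (algebraMap F E c * a ^ (i + 2)) * v (algebraMap F E c * a ^ (i + 1))⁻¹ = v a := by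
        rw [← map_mul]
        congr 1
        have : algebraMap F E c ≠ 0 := by simpa using hc
        have := ha.ne_zero
        field_simp
        ring
      have h4 := mul_lt_mul'' h1 h2 zero_le zero_le
      rw [← mul_pow, h3, pow_two] at h4
      exact lt_irrefl _ h4
  let ι := {d : F // IsSmallOutside F v (algebraMap F E d * a)}
  have : Nonempty ι := ⟨⟨1, by simpa using ha⟩⟩
  -- each coefficient is dominated by a suitable multiple of `a`
  have hcoeff : ∀ c : F, ∀ i, i < q → v (algebraMap F E c * a ^ i) ≤ 1 →
      ∃ d : ι, ∀ e : ι, v (algebraMap F E d.1) ≤ v (algebraMap F E e.1) →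
        v (algebraMap F E c) ≤ v (algebraMap F E e.1) ^ i := by
    intro c i hi h
    rcases Nat.eq_zero_or_pos i with rfl | hi0
    · exact ⟨Classical.arbitrary ι, fun e _ => by simpa using h⟩
    obtain ⟨i, rfl⟩ := Nat.exists_eq_add_of_lt hi0
    rw [zero_add] at hi h ⊢
    -- An integral `c` is dominated once `v e ≥ 1`; otherwise `c` itself is an admissible scale, and
    -- `v c ≤ v e ≤ v e ^ i`.
    by_cases hc1 : v (algebraMap F E c) ≤ 1
    · refine ⟨⟨1, by simpa using ha⟩, fun e he => hc1.trans (one_le_pow₀ ?_)⟩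
      simpa using he
    · push Not at hc1
      have hc : c ≠ 0 := by
        rintro rfl
        simp at hc1
      refine ⟨⟨c, hdesc i hi c hc h⟩, fun e he => he.trans ?_⟩
      exact le_self_pow₀ (hc1.le.trans he) (by omega)
  refine IsExhaustedByMonogenic.of_family v (ι := ι) (fun d => v (algebraMap F E d.1))
    (fun d => algebraMap F E d.1 * a) (fun d => d.2.1.le) fun y hy => ?_
  obtain ⟨g, hg, rfl⟩ := hgen y
  obtain ⟨-, -, -, hle⟩ := exists_val_aeval_eq v haq ha.ne_zero hg
  have hall : ∀ n ≤ q, ∃ d : ι, ∀ e : ι, v (algebraMap F E d.1) ≤ v (algebraMap F E e.1) →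
      ∀ i < n, v (algebraMap F E (g.coeff i)) ≤ v (algebraMap F E e.1) ^ i := by
    intro n
    induction n with
    | zero => exact fun _ => ⟨Classical.arbitrary ι, fun _ _ i hi => absurd hi (by omega)⟩
    | succ n ih =>
      intro hn
      obtain ⟨d, hd⟩ := ih (by omega)
      obtain ⟨d', hd'⟩ := hcoeff (g.coeff n) n (by omega) (by
        rw [map_mul, map_pow]
        exact (hle n).trans hy)
      rcases le_total (v (algebraMap F E d.1)) (v (algebraMap F E d'.1)) with h | h
      · refine ⟨d', fun e he i hi => ?_⟩
        rcases Nat.lt_succ_iff_lt_or_eq.1 hi with hi | rfl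
        · exact hd e (h.trans he) i hi
        · exact hd' e he
      · refine ⟨d, fun e he i hi => ?_⟩
        rcases Nat.lt_succ_iff_lt_or_eq.1 hi with hi | rfl
        · exact hd e he i hi
        · exact hd' e (h.trans he)
  obtain ⟨d, hd⟩ := hall q le_rfl
  refine ⟨d, fun e he => ⟨g.comp (C e.1⁻¹ * X), fun i => ?_, ?_⟩⟩
  · by_cases hi : i < q
    · have hepos : 0 < v (algebraMap F E e.1) := zero_lt_iff.2 fun h0 => e.2.ne_zero
        (by rw [(Valuation.zero_iff v).1 h0, zero_mul])
      rw [comp_C_mul_X_coeff, map_mul, map_mul, map_pow, map_pow, map_inv₀, map_inv₀, inv_pow]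
      exact mul_inv_le_one_of_le₀ (hd e he i hi) (pow_pos hepos i).le
    · rw [comp_C_mul_X_coeff, coeff_eq_zero_of_natDegree_lt (by omega : g.natDegree < i)]
      simp
  · have he0 : algebraMap F E e.1 ≠ 0 := left_ne_zero_of_mul e.2.ne_zero
    rw [aeval_comp, map_mul, aeval_C, aeval_X, map_inv₀, inv_mul_cancel_left₀ he0]

/-- The ramified case. -/
theorem IsExhaustedByMonogenic.of_ramified [FiniteDimensional F E] [IsGalois F E]
    (hq : (Module.finrank F E).Prime) (hv : ∀ (σ : E ≃ₐ[F] E) (x : E), v (σ x) = v x)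
    (h : ∃ a : E, ∀ c : F, v a ≠ v (algebraMap F E c)) : IsExhaustedByMonogenic F v := by
  have hS : ∀ b, IsSmallOutside F v b →
      ∀ i, 0 < i → i < Module.finrank F E → ∀ c : F, v b ^ i ≠ v (algebraMap F E c) :=
    fun b hb i hi0 hi => val_pow_ne_of_coprime v hb.2 (val_pow_eq_val_norm v hv b)
      ((Nat.coprime_of_lt_prime hi0.ne' hi hq).symm)
  have hgen : ∀ b, IsSmallOutside F v b →
      ∀ y : E, ∃ g : F[X], g.natDegree < Module.finrank F E ∧ aeval b g = y :=
    fun b hb => exists_aeval_eq_of_finrank_prime hq fun ⟨c, hc⟩ => hb.2 c (by rw [hc])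
  obtain ⟨a, ha⟩ : ∃ a, IsSmallOutside F v a := by
    obtain ⟨a, ha⟩ := h
    rcases lt_trichotomy (v a) 1 with h1 | h1 | h1
    · exact ⟨a, h1, ha⟩
    · exact absurd h1 (by simpa using ha 1)
    · refine ⟨a⁻¹, ?_, fun c hc => ha c⁻¹ ?_⟩
      · rw [map_inv₀]
        exact inv_lt_one_of_one_lt₀ h1
      · rw [map_inv₀, map_inv₀, ← hc, map_inv₀, inv_inv]
  by_cases hd : ∀ x, IsSmallOutside F v x → ∃ b, IsSmallOutside F v b ∧ v x ≤ v b ^ 2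
  · exact .of_isSmallOutside_dense ha hS hgen hd
  · push Not at hd
    obtain ⟨x, hx, hxd⟩ := hd
    exact .of_isSmallOutside_discrete hx (hS x hx) (hgen x hx) hxd

end Ramified

end ValTower

end

/-! ### Galois steps with a new residue -/

section

open Polynomial

/-- Every irreducible factor of `f` is an associate of the minimal polynomial, so `f` is a power of
it up to a unit. -/
theorem Polynomial.natDegree_minpoly_dvd_natDegree {k κ : Type*} [Field k] [Field κ] [Algebra k κ]
    (x : κ) {f : k[X]} (hf0 : f ≠ 0)
    (hf : ∀ p : k[X], Irreducible p → p ∣ f → aeval x p = 0) :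
    (minpoly k x).natDegree ∣ f.natDegree := by
  induction f using WfDvdMonoid.induction_on_irreducible with
  | zero => exact absurd rfl hf0
  | unit u hu => simp [natDegree_eq_zero_of_isUnit hu]
  | mul a i ha hi ih =>
    rw [natDegree_mul hi.ne_zero ha]
    refine dvd_add ?_ (ih ha fun p hp hpa => hf p hp (dvd_mul_of_dvd_right hpa i))
    have h1 := minpoly.eq_of_irreducible hi (hf i hi (dvd_mul_right i a))
    rw [← h1, natDegree_mul_C (inv_ne_zero (leadingCoeff_ne_zero.2 hi.ne_zero))]

namespace ValTower

theorem residue_valRing_eq_zero_iff {L Γ : Type*} [Field L] [LinearOrderedCommGroupWithZero Γ]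
    (ν : Valuation L Γ) (F : Type*) [Field F] [Algebra F L] (x : valRing ν F) :
    IsLocalRing.residue (valRing ν F) x = 0 ↔ ν (algebraMap F L x) < 1 := by
  rw [IsLocalRing.residue_eq_zero_iff, IsLocalRing.mem_maximalIdeal, mem_nonunits_iff,
    ← not_le, not_iff_not]
  constructor
  · intro h
    obtain ⟨y, hy⟩ := isUnit_iff_exists_inv.1 h
    have h1 : ν (algebraMap F L x) * ν (algebraMap F L y) = 1 := by
      rw [← map_mul, ← map_mul, show (x : F) * y = 1 from congrArg Subtype.val hy, map_one, map_one]
    by_contra! hlt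
    exact (mul_lt_one_of_lt_of_le hlt y.2).ne h1
  · intro h
    have hx0 : (x : F) ≠ 0 := by
      intro h0
      rw [h0, map_zero, map_zero] at h
      exact absurd h (not_le.2 zero_lt_one)
    refine isUnit_iff_exists_inv.2 ⟨⟨(x : F)⁻¹, ?_⟩, Subtype.ext (mul_inv_cancel₀ hx0)⟩
    rw [mem_valRing, map_inv₀, map_inv₀]
    exact inv_le_one_of_one_le₀ h

section Residue

variable {L Γ : Type*} [Field L] [LinearOrderedCommGroupWithZero Γ]
  (ν : Valuation L Γ) {F E : Type*} [Field F] [Field E] [Algebra F L] [Algebra E L]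
  [Algebra F E] [IsScalarTower F E L]

theorem aeval_residue_map (a : valRing ν E) (P : (valRing ν F)[X]) :
    aeval (IsLocalRing.residue (valRing ν E) a) (P.map (IsLocalRing.residue (valRing ν F))) =
      IsLocalRing.residue (valRing ν E) (aeval a P) := by
  rw [← IsLocalRing.ResidueField.algebraMap_eq, ← IsLocalRing.ResidueField.algebraMap_eq,
    aeval_map_algebraMap, aeval_algebraMap_apply]

theorem coe_aeval_valRing (a : valRing ν E) (P : (valRing ν F)[X]) :
    ((aeval a P : valRing ν E) : E) = aeval (a : E) (P.map (valRing ν F).subtype) := by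
  rw [aeval_def, aeval_def, eval₂_map]
  exact hom_eval₂ P (algebraMap (valRing ν F) (valRing ν E)) (valRing ν E).subtype a

theorem exists_map_subtype_eq {g : F[X]} (hg : ∀ i, ν (algebraMap F L (g.coeff i)) ≤ 1) :
    ∃ P : (valRing ν F)[X], P.map (valRing ν F).subtype = g ∧ P.natDegree = g.natDegree := by
  have h : g ∈ lifts (valRing ν F).subtype :=
    (lifts_iff_coeff_lifts _).2 fun i => ⟨⟨g.coeff i, hg i⟩, rfl⟩
  obtain ⟨P, hP, hdeg⟩ := exists_natDegree_eq_of_mem_lifts h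
  exact ⟨P, hP, hdeg⟩

end Residue

/-- If primitive polynomials of degree less than `n` take unit values at `a`, then the value at `a`
of a polynomial of degree less than `n` is at least the values of its coefficients. -/
theorem val_coeff_le_val_aeval {F E Γ : Type*} [Field F] [Field E]
    [Algebra F E] [LinearOrderedCommGroupWithZero Γ] (v : Valuation E Γ) {a : E} {n : ℕ}
    (ha : ∀ g : F[X], g.natDegree < n → (∀ i, v (algebraMap F E (g.coeff i)) ≤ 1) →
      (∃ i, v (algebraMap F E (g.coeff i)) = 1) → v (aeval a g) = 1)
    {g : F[X]} (hg : g.natDegree < n) (i : ℕ) :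
    v (algebraMap F E (g.coeff i)) ≤ v (aeval a g) := by
  obtain ⟨j, -, hj⟩ := Finset.exists_max_image (Finset.range n)
    (fun i => v (algebraMap F E (g.coeff i))) ⟨0, Finset.mem_range.2 (by omega)⟩
  have hmax : ∀ i, v (algebraMap F E (g.coeff i)) ≤ v (algebraMap F E (g.coeff j)) := fun i => by
    by_cases hi : i < n
    · exact hj i (Finset.mem_range.2 hi)
    · rw [coeff_eq_zero_of_natDegree_lt (by omega : g.natDegree < i)]
      simp
  refine (hmax i).trans ?_
  by_cases hj0 : v (algebraMap F E (g.coeff j)) = 0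
  · rw [hj0]
    exact zero_le
  have h1 := ha (C (g.coeff j)⁻¹ * g) ((natDegree_C_mul_le _ _).trans_lt hg)
    (fun i => by
      rw [coeff_C_mul, map_mul, map_mul, map_inv₀, map_inv₀, mul_comm]
      exact mul_inv_le_one_of_le₀ (hmax i) zero_le)
    ⟨j, by rw [coeff_C_mul, map_mul, map_mul, map_inv₀, map_inv₀, inv_mul_cancel₀ hj0]⟩
  rw [map_mul, aeval_C, map_mul, map_inv₀, map_inv₀, inv_mul_eq_one₀ hj0] at h1
  exact h1.le

section Galois

variable {F E Γ : Type*} [Field F] [Field E] [Algebra F E] [LinearOrderedCommGroupWithZero Γ]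
  (v : Valuation E Γ) [IsGalois F E]

theorem val_root_minpoly (hv : ∀ (σ : E ≃ₐ[F] E) (x : E), v (σ x) = v x) {a ρ : E}
    (h : aeval ρ (minpoly F a) = 0) : v ρ = v a := by
  obtain ⟨σ, rfl⟩ := minpoly.exists_algEquiv_of_root (Algebra.IsAlgebraic.isAlgebraic a) h
  exact (hv σ ρ).symm

/-- All roots are conjugates of `a`, hence integral, and the minimal polynomial splits over the
valuation ring of `E`. -/
theorem val_coeff_minpoly_le_one (hv : ∀ (σ : E ≃ₐ[F] E) (x : E), v (σ x) = v x) {a : E}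
    (ha : v a ≤ 1) (i : ℕ) : v (algebraMap F E ((minpoly F a).coeff i)) ≤ 1 := by
  have hm : (minpoly F a).Monic := minpoly.monic (Algebra.IsIntegral.isIntegral a)
  have h := (Normal.splits (inferInstance : Normal F E) a).mem_lift_of_roots_mem_range
    (hm.map (algebraMap F E)) v.valuationSubring.subtype fun ρ hρ => by
      have h1 : aeval ρ (minpoly F a) = 0 := by
        have := isRoot_of_mem_roots hρ
        rwa [IsRoot.def, eval_map_algebraMap] at this
      exact ⟨⟨ρ, by
        rw [Valuation.mem_valuationSubring_iff, val_root_minpoly v hv h1]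
        exact ha⟩, rfl⟩
  obtain ⟨x, hx⟩ := (lifts_iff_coeff_lifts _).1 h i
  rw [coeff_map] at hx
  rw [← hx]
  exact x.2

variable [FiniteDimensional F E]

/-- The residue of `a` has degree `[E : F]` over the residue field of `F` unless it lies in it. -/
theorem val_aeval_eq_one (hq : (Module.finrank F E).Prime)
    (hv : ∀ (σ : E ≃ₐ[F] E) (x : E), v (σ x) = v x) {a : E} (ha : v a ≤ 1)
    (ha' : ∀ c : F, 1 ≤ v (a - algebraMap F E c)) {g : F[X]}
    (hg : g.natDegree < Module.finrank F E) (hg1 : ∀ i, v (algebraMap F E (g.coeff i)) ≤ 1)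
    (hgu : ∃ i, v (algebraMap F E (g.coeff i)) = 1) : v (aeval a g) = 1 := by
  have hrange : a ∉ Set.range (algebraMap F E) := by
    rintro ⟨c, rfl⟩
    have := ha' c
    simp at this
  set π := IsLocalRing.residue (valRing v F) with hπ
  set ϖ := IsLocalRing.residue (valRing v E) with hϖ
  let a' : valRing v E := ⟨a, ha⟩
  -- the reduction of the minimal polynomial
  obtain ⟨f, hf, hfdeg⟩ := exists_map_subtype_eq v (val_coeff_minpoly_le_one v hv ha)
  rw [natDegree_minpoly_of_finrank_prime hq hrange] at hfdeg
  have hfm : f.Monic := by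
    have h1 := minpoly.monic (A := F) (x := a) (Algebra.IsIntegral.isIntegral a)
    rw [← hf] at h1
    exact monic_of_injective Subtype.val_injective h1
  have hfE : (f.map (algebraMap (valRing v F) (valRing v E))).map (valRing v E).subtype =
      (minpoly F a).map (algebraMap F E) := by
    rw [← hf, Polynomial.map_map, Polynomial.map_map]
    rfl
  have hfroot : ∀ ρ : valRing v E, (f.map (algebraMap (valRing v F) (valRing v E))).IsRoot ρ →
      aeval (ρ : E) (minpoly F a) = 0 := by
    intro ρ hρ
    rw [← eval_map_algebraMap, ← hfE]
    rw [IsRoot.def] at hρ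
    have h1 := eval_map_apply (p := f.map (algebraMap (valRing v F) (valRing v E))) (valRing v E).subtype ρ
    rw [hρ, map_zero] at h1
    exact h1
  have hfs : (f.map (algebraMap (valRing v F) (valRing v E))).Splits := by
    refine Splits.of_splits_map_of_injective (i := (valRing v E).subtype) Subtype.val_injective
      ?_ fun ρ hρ => ?_
    · rw [hfE]
      exact Normal.splits (inferInstance : Normal F E) a
    · rw [hfE] at hρ
      have h1 : aeval ρ (minpoly F a) = 0 := by
        have := isRoot_of_mem_roots hρ
        rwa [IsRoot.def, eval_map_algebraMap] at this
      exact ⟨⟨ρ, (val_root_minpoly v hv h1).trans_le ha⟩, rfl⟩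
  -- An irreducible factor of the reduction of `f` vanishes at the residue of some conjugate `ρ` of
  -- `a`; applying `σ` with `σ ρ = a` to a lift shows that it vanishes at the residue of `a`.
  have hdvd : (minpoly (resField v F) (ϖ a')).natDegree ∣ Module.finrank F E := by
    have h1 : (f.map π).natDegree = Module.finrank F E := by rw [hfm.natDegree_map, hfdeg]
    rw [← h1]
    refine natDegree_minpoly_dvd_natDegree _ (hfm.map π).ne_zero fun p hp hpf => ?_
    have hcomp : (f.map π).map (algebraMap (resField v F) (resField v E)) =
        (f.map (algebraMap (valRing v F) (valRing v E))).map ϖ := by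
      rw [Polynomial.map_map, Polynomial.map_map]
      rfl
    have hne : (f.map (algebraMap (valRing v F) (valRing v E))).map ϖ ≠ 0 :=
      ((hfm.map _).map _).ne_zero
    have hpdvd : p.map (algebraMap (resField v F) (resField v E)) ∣
        (f.map (algebraMap (valRing v F) (valRing v E))).map ϖ :=
      hcomp ▸ Polynomial.map_dvd _ hpf
    obtain ⟨x, hx⟩ := ((hfs.map ϖ).of_dvd hne hpdvd).exists_eval_eq_zero (by
      rw [degree_map]
      exact hp.degree_pos.ne')
    have hxmem : x ∈ ((f.map (algebraMap (valRing v F) (valRing v E))).map ϖ).roots :=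
      (mem_roots hne).2 (IsRoot.dvd hx hpdvd)
    rw [hfs.roots_map_of_ne_zero hne] at hxmem
    obtain ⟨ρ, hρ, rfl⟩ := Multiset.mem_map.1 hxmem
    obtain ⟨σ, hσ⟩ := minpoly.exists_algEquiv_of_root (Algebra.IsAlgebraic.isAlgebraic a)
      (hfroot ρ (isRoot_of_mem_roots hρ))
    obtain ⟨P, rfl⟩ := Polynomial.map_surjective π (IsLocalRing.residue_surjective) p
    rw [eval_map_algebraMap, aeval_residue_map, residue_valRing_eq_zero_iff] at hx
    rw [aeval_residue_map, residue_valRing_eq_zero_iff]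
    rw [Algebra.algebraMap_self, RingHom.id_apply, coe_aeval_valRing] at hx ⊢
    rw [show ((a' : valRing v E) : E) = σ ρ from hσ.symm, ← AlgEquiv.coe_toAlgHom,
      aeval_algHom_apply, AlgEquiv.coe_toAlgHom, hv]
    exact hx
  obtain ⟨G, rfl, hG⟩ := exists_map_subtype_eq v hg1
  rw [show a = ((a' : valRing v E) : E) from rfl, ← coe_aeval_valRing] at *
  by_contra hne
  have hga : v ((aeval a' G : valRing v E) : E) < 1 := lt_of_le_of_ne (aeval a' G).2 hne
  have hG0 : aeval (ϖ a') (G.map π) = 0 := by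
    rw [aeval_residue_map, residue_valRing_eq_zero_iff]
    exact hga
  have hGne : G.map π ≠ 0 := by
    intro h0
    obtain ⟨i, hi⟩ := hgu
    have h1 : π (G.coeff i) = 0 := by rw [← coeff_map, h0, coeff_zero]
    rw [residue_valRing_eq_zero_iff] at h1
    rw [coeff_map] at hi
    exact h1.ne hi
  have hlt : (minpoly (resField v F) (ϖ a')).natDegree < Module.finrank F E :=
    (natDegree_le_of_dvd (minpoly.dvd _ _ hG0) hGne).trans_lt
      (natDegree_map_le.trans_lt (hG ▸ hg))
  -- The degree is a proper divisor of a prime, hence `1`: the residue of `a` comes from `F`,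
  -- against `ha'`.
  obtain ⟨c, hc⟩ := minpoly.natDegree_eq_one_iff.1 (((Nat.dvd_prime hq).1 hdvd).resolve_right hlt.ne)
  obtain ⟨c, rfl⟩ := IsLocalRing.residue_surjective c
  have h1 : ϖ (a' - algebraMap (valRing v F) (valRing v E) c) = 0 := by
    rw [map_sub, ← hc, sub_eq_zero]
    rfl
  rw [residue_valRing_eq_zero_iff] at h1
  exact absurd (ha' c) (not_le.2 h1)

/-- The case of a residue field extension of full degree. -/
theorem IsExhaustedByMonogenic.of_residue (hq : (Module.finrank F E).Prime)
    (hv : ∀ (σ : E ≃ₐ[F] E) (x : E), v (σ x) = v x) {a : E} (ha : v a ≤ 1)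
    (ha' : ∀ c : F, 1 ≤ v (a - algebraMap F E c)) : IsExhaustedByMonogenic F v := by
  have hrange : a ∉ Set.range (algebraMap F E) := by
    rintro ⟨c, rfl⟩
    have := ha' c
    simp at this
  refine fun s hs => ⟨a, ha, fun y hy => ?_⟩
  obtain ⟨g, hg, rfl⟩ := exists_aeval_eq_of_finrank_prime hq hrange y
  exact ⟨g, fun i => (val_coeff_le_val_aeval v
    (fun g hg hg1 hgu => val_aeval_eq_one v hq hv ha ha' hg hg1 hgu) hg i).trans (hs _ hy), rfl⟩

end Galois

end ValTower

end

/-! ### Immediate Galois steps: Newton approximation and coarsening -/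

section

open Polynomial

theorem Polynomial.aeval_eq_aeval_sub_taylor {F E : Type*} [CommRing F] [CommRing E] [Algebra F E]
    (g : F[X]) (a : E) (c : F) : aeval a g = aeval (a - algebraMap F E c) (taylor c g) := by
  rw [taylor_apply, aeval_comp, map_add, aeval_X, aeval_C, sub_add_cancel]

theorem Polynomial.coeff_taylor_derivative {R : Type*} [CommRing R] (g : R[X]) (c : R) (i : ℕ) :
    (taylor c (derivative g)).coeff i = (taylor c g).coeff (i + 1) * (i + 1) := by
  rw [← coeff_derivative, taylor_apply, taylor_apply, derivative_comp]
  simp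

namespace ValTower

section Immediate

variable {F E Γ : Type*} [Field F] [Field E] [Algebra F E] [LinearOrderedCommGroupWithZero Γ]
  {v : Valuation E Γ}

theorem val_aeval_le {x : E} {B : Γ} {g : F[X]}
    (h : ∀ i, v (algebraMap F E (g.coeff i)) * v x ^ i ≤ B) : v (aeval x g) ≤ B := by
  rw [aeval_eq_sum_range]
  refine v.map_sum_le fun i _ => ?_
  rw [Algebra.smul_def, map_mul, map_pow]
  exact h i

theorem val_aeval_lt {x : E} {B : Γ} (hB : 0 < B) {g : F[X]}
    (h : ∀ i, v (algebraMap F E (g.coeff i)) * v x ^ i < B) : v (aeval x g) < B := by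
  rw [aeval_eq_sum_range]
  refine v.map_sum_lt' hB fun i _ => ?_
  rw [Algebra.smul_def, map_mul, map_pow]
  exact h i

theorem val_coeff_taylor_le_one {g : F[X]} (hg : ∀ i, v (algebraMap F E (g.coeff i)) ≤ 1) {c : F}
    (hc : v (algebraMap F E c) ≤ 1) (i : ℕ) : v (algebraMap F E ((taylor c g).coeff i)) ≤ 1 := by
  obtain ⟨P, rfl, -⟩ := exists_map_subtype_eq v hg
  have h : taylor c (P.map (valRing v F).subtype) =
      (taylor (⟨c, hc⟩ : valRing v F) P).map (valRing v F).subtype := by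
    rw [map_taylor]
    rfl
  rw [h, coeff_map]
  exact ((taylor (⟨c, hc⟩ : valRing v F) P).coeff i).2

/-- If the distances of `a` to elements of `F` are closed under squaring up to passing to smaller
ones, the elements whose value is bounded by the inverse of a distance form a valuation ring. -/
def coarsening (v : Valuation E Γ) (a : E) (ha : v a ≤ 1)
    (hsq : ∀ c d : F, ∃ e : F, v (a - algebraMap F E e) ≤
      v (a - algebraMap F E c) * v (a - algebraMap F E d)) : ValuationSubring E where
  carrier := {x | ∃ c : F, v x * v (a - algebraMap F E c) ≤ 1}
  mul_mem' := by
    rintro x y ⟨c, hc⟩ ⟨d, hd⟩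
    obtain ⟨e, he⟩ := hsq c d
    refine ⟨e, (mul_le_mul_right he _).trans ?_⟩
    rw [map_mul, mul_mul_mul_comm]
    exact mul_le_one' hc hd
  one_mem' := ⟨0, by simpa using ha⟩
  add_mem' := by
    rintro x y ⟨c, hc⟩ ⟨d, hd⟩
    obtain ⟨e, hec, hed⟩ : ∃ e : F, v (a - algebraMap F E e) ≤ v (a - algebraMap F E c) ∧
        v (a - algebraMap F E e) ≤ v (a - algebraMap F E d) := by
      rcases le_total (v (a - algebraMap F E c)) (v (a - algebraMap F E d)) with h | h
      · exact ⟨c, le_rfl, h⟩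
      · exact ⟨d, h, le_rfl⟩
    refine ⟨e, ?_⟩
    rw [← map_mul, add_mul]
    refine v.map_add_le ?_ ?_
    · rw [map_mul]
      exact (mul_le_mul_right hec _).trans hc
    · rw [map_mul]
      exact (mul_le_mul_right hed _).trans hd
  zero_mem' := ⟨0, by simp⟩
  neg_mem' := by
    rintro x ⟨c, hc⟩
    exact ⟨c, by rwa [v.map_neg]⟩
  mem_or_inv_mem' x := by
    have h : ∀ y : E, v y ≤ 1 → ∃ c : F, v y * v (a - algebraMap F E c) ≤ 1 :=
      fun y hy => ⟨0, mul_le_one' hy (by simpa using ha)⟩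
    rcases le_total (v x) 1 with hx | hx
    · exact Or.inl (h x hx)
    · refine Or.inr (h _ ?_)
      rw [map_inv₀]
      exact inv_le_one_of_one_le₀ hx

theorem mem_coarsening {a : E} {ha : v a ≤ 1}
    {hsq : ∀ c d : F, ∃ e : F, v (a - algebraMap F E e) ≤
      v (a - algebraMap F E c) * v (a - algebraMap F E d)} {x : E} :
    x ∈ coarsening v a ha hsq ↔ ∃ c : F, v x * v (a - algebraMap F E c) ≤ 1 := Iff.rfl

variable [FiniteDimensional F E] [IsGalois F E]

/-- Newton steps make the distances from `a` to `F` closed under squaring, so their inverses define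
a coarsening of `v`. There the residue of `a` is new, so `g(a)` is a unit of the coarsening, which
keeps `v (g(a))` above some distance; but it lies below all of them. -/
theorem not_isRoot_approx (hq : (Module.finrank F E).Prime)
    (hv : ∀ (σ : E ≃ₐ[F] E) (x : E), v (σ x) = v x) {a : E} (ha : v a ≤ 1)
    (hmin : ∀ c : F, ∃ d : F, v (a - algebraMap F E d) < v (a - algebraMap F E c))
    {g : F[X]} (hg : g.natDegree < Module.finrank F E)
    (hg1 : ∀ i, v (algebraMap F E (g.coeff i)) ≤ 1)
    (hder : ∀ c : F, v (a - algebraMap F E c) ≤ 1 →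
      v (algebraMap F E ((taylor c g).coeff 1)) = 1)
    (hsmall : ∀ c : F, v (a - algebraMap F E c) ≤ 1 → v (aeval a g) ≤ v (a - algebraMap F E c)) :
    False := by
  have ha0 : v (a - algebraMap F E 0) ≤ 1 := by simpa using ha
  have hpos : ∀ c : F, 0 < v (a - algebraMap F E c) := fun c => by
    obtain ⟨d, hd⟩ := hmin c
    exact zero_le.trans_lt hd
  have hlt : ∀ c : F, v (aeval a g) < v (a - algebraMap F E c) := by
    intro c
    obtain ⟨d, hd⟩ := hmin c
    rcases le_total (v (a - algebraMap F E d)) 1 with h | h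
    · exact (hsmall d h).trans_lt hd
    · exact ((hsmall 0 ha0).trans ha0).trans_lt (h.trans_lt hd)
  have hnewton : ∀ c : F, v (a - algebraMap F E c) ≤ 1 →
      ∃ d : F, v (a - algebraMap F E d) ≤ v (a - algebraMap F E c) ^ 2 := by
    intro c hc
    have hc1 : v (algebraMap F E c) ≤ 1 := by
      have := v.map_sub_le ha hc
      rwa [sub_sub_cancel] at this
    have hcoeff := val_coeff_taylor_le_one hg1 hc1
    set τ := taylor c g with hτ
    set x := a - algebraMap F E c with hx
    have h1 : algebraMap F E (τ.coeff 1) ≠ 0 := by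
      rw [← Valuation.ne_zero_iff v, hder c hc]
      exact one_ne_zero
    have hrest : v (aeval x (τ - C (τ.coeff 0) - C (τ.coeff 1) * X)) ≤ v x ^ 2 := by
      refine val_aeval_le fun i => ?_
      match i with
      | 0 => simp
      | 1 => simp
      | i + 2 =>
        have : (τ - C (τ.coeff 0) - C (τ.coeff 1) * X).coeff (i + 2) = τ.coeff (i + 2) := by
          simp
        rw [this, pow_add, ← mul_assoc]
        exact mul_le_of_le_one_left' (mul_le_one' (hcoeff _) (pow_le_one' hc i))
    refine ⟨c - τ.coeff 0 / τ.coeff 1, ?_⟩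
    have hval : v (a - algebraMap F E (c - τ.coeff 0 / τ.coeff 1)) =
        v (aeval a g - aeval x (τ - C (τ.coeff 0) - C (τ.coeff 1) * X)) := by
      rw [← one_mul (v (a - _)), ← hder c hc, ← map_mul, aeval_eq_aeval_sub_taylor g a c]
      congr 1
      simp only [map_sub, map_mul, aeval_C, aeval_X, map_div₀]
      rw [← hτ, ← hx]
      field_simp
      rw [hx]
      ring
    rw [hval]
    refine (v.map_sub _ _).trans (max_le ?_ hrest)
    -- Otherwise the Newton iterate would lie at distance exactly `v (g(a))`, which is smaller than
    -- every distance.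
    by_contra! hcon
    have h2 : v (aeval a g - aeval x (τ - C (τ.coeff 0) - C (τ.coeff 1) * X)) = v (aeval a g) :=
      v.map_sub_eq_of_lt_left (hrest.trans_lt hcon)
    rw [h2] at hval
    exact (hlt _).ne hval.symm
  have hsq : ∀ c d : F, ∃ e : F, v (a - algebraMap F E e) ≤
      v (a - algebraMap F E c) * v (a - algebraMap F E d) := by
    have key : ∀ c d : F, v (a - algebraMap F E c) ≤ v (a - algebraMap F E d) →
        ∃ e : F, v (a - algebraMap F E e) ≤ v (a - algebraMap F E c) * v (a - algebraMap F E d) := by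
      intro c d hcd
      rcases le_total (v (a - algebraMap F E c)) 1 with h | h
      · obtain ⟨e, he⟩ := hnewton c h
        refine ⟨e, he.trans ?_⟩
        rw [pow_two]
        exact mul_le_mul_right hcd _
      · exact ⟨0, ha0.trans (one_le_mul h (h.trans hcd))⟩
    intro c d
    rcases le_total (v (a - algebraMap F E c)) (v (a - algebraMap F E d)) with h | h
    · exact key c d h
    · rw [mul_comm]
      exact key d c h
  set O := coarsening v a ha hsq with hO
  have hmem : ∀ x : E, v x ≤ 1 → O.valuation x ≤ 1 := fun x hx =>
    (O.valuation_le_one_iff x).2 (mem_coarsening.2 ⟨0, mul_le_one' hx ha0⟩)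
  have hunit : ∀ x : E, v x = 1 → O.valuation x = 1 := fun x hx => by
    refine le_antisymm (hmem x hx.le) ?_
    have h1 := hmem x⁻¹ (by rw [map_inv₀, hx, inv_one])
    have hx0 : O.valuation x ≠ 0 := by
      rw [Valuation.ne_zero_iff, ← Valuation.ne_zero_iff v, hx]
      exact one_ne_zero
    rw [map_inv₀] at h1
    exact (inv_le_one₀ (zero_lt_iff.2 hx0)).1 h1
  have hinv : ∀ x : E, x ≠ 0 → x⁻¹ ∈ O → 1 ≤ O.valuation x := fun x hx h => by
    have h1 := (O.valuation_le_one_iff _).2 h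
    rw [map_inv₀] at h1
    exact (inv_le_one₀ (zero_lt_iff.2 ((Valuation.ne_zero_iff _).2 hx))).1 h1
  have hOv : ∀ (σ : E ≃ₐ[F] E) (x : E), O.valuation (σ x) = O.valuation x := by
    intro σ x
    rcases eq_or_ne x 0 with rfl | hx
    · rw [map_zero]
    have h1 := hunit (σ x / x) (by
      rw [map_div₀, hv, div_self ((Valuation.ne_zero_iff v).2 hx)])
    rw [map_div₀, div_eq_one_iff_eq ((Valuation.ne_zero_iff _).2 hx)] at h1
    exact h1
  -- The inverse of each `a - c` lies in `O`, so no `a - c` has `O`-value below `1`.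
  have hfin := val_aeval_eq_one O.valuation hq hOv (hmem a ha) (fun c => by
    refine hinv _ ((Valuation.ne_zero_iff v).1 (hpos c).ne') (mem_coarsening.2 ⟨c, ?_⟩)
    rw [map_inv₀, inv_mul_cancel₀ (hpos c).ne']) hg (fun i => hmem _ (hg1 i))
    ⟨1, hunit _ (by simpa using hder 0 ha0)⟩
  have hne : aeval a g ≠ 0 := by
    rw [← Valuation.ne_zero_iff O.valuation, hfin]
    exact one_ne_zero
  obtain ⟨c, hc⟩ := mem_coarsening.1 ((O.valuation_le_one_iff (aeval a g)⁻¹).1 (by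
    rw [map_inv₀, hfin, inv_one]))
  rw [map_inv₀, inv_mul_le_one₀ (zero_lt_iff.2 ((Valuation.ne_zero_iff v).2 hne))] at hc
  exact absurd (hlt c) (not_lt.2 hc)

/-- Otherwise the normalised trace `t` would be a closest element of `F`: `n (a - t)` is the sum of
the `a - σ a`, each bounded by `v (a - d)` for every `d` in `F`. -/
theorem val_natCast_finrank_lt_one (hv : ∀ (σ : E ≃ₐ[F] E) (x : E), v (σ x) = v x) {a : E}
    (hmin : ∀ c : F, ∃ d : F, v (a - algebraMap F E d) < v (a - algebraMap F E c)) :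
    v (Module.finrank F E : E) < 1 := by
  classical
  refine lt_of_not_ge fun h => ?_
  set n : E := (Module.finrank F E : E) with hn
  have hn0 : n ≠ 0 := by
    rw [← Valuation.ne_zero_iff v]
    exact (zero_lt_one.trans_le h).ne'
  set t : F := Algebra.trace F E a / (Module.finrank F E : F) with ht
  obtain ⟨d, hd⟩ := hmin t
  have h1 : n * (a - algebraMap F E t) = ∑ σ : E ≃ₐ[F] E, (a - σ a) := by
    rw [Finset.sum_sub_distrib, ← trace_eq_sum_automorphisms, Finset.sum_const, Finset.card_univ,
      ← Nat.card_eq_fintype_card, IsGalois.card_aut_eq_finrank, nsmul_eq_mul, ht, map_div₀,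
      map_natCast, mul_sub, mul_div_cancel₀ _ hn0]
  have h2 : v (n * (a - algebraMap F E t)) ≤ v (a - algebraMap F E d) := by
    rw [h1]
    refine v.map_sum_le fun σ _ => ?_
    have h3 : a - σ a = (a - algebraMap F E d) - σ (a - algebraMap F E d) := by
      rw [map_sub, σ.commutes]
      ring
    rw [h3]
    exact v.map_sub_le le_rfl (hv _ _).le
  rw [map_mul] at h2
  exact absurd ((le_mul_of_one_le_left' h).trans h2) (not_le.2 hd)

theorem val_natCast_eq_one {q i : ℕ} (h : v (q : E) < 1) (hi : i.Coprime q) : v (i : E) = 1 := by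
  have hle : ∀ n : ℤ, v (n : E) ≤ 1 := fun n => by
    have := intCast_mem v.integer n
    exact this
  refine le_antisymm (by simpa using hle i) (le_of_not_gt fun hlt => ?_)
  have h1 := congrArg (fun n : ℤ => (n : E)) (Nat.gcd_eq_gcd_ab i q)
  simp only [hi.gcd_eq_one] at h1
  push_cast at h1
  have h2 : v (1 : E) < 1 := by
    rw [h1]
    refine v.map_add_lt ?_ ?_
    · rw [map_mul]
      exact mul_lt_one_of_lt_of_le hlt (hle _)
    · rw [map_mul]
      exact mul_lt_one_of_lt_of_le h (hle _)
  rw [map_one] at h2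
  exact lt_irrefl _ h2

end Immediate

end ValTower

end

/-! ### Immediate Galois steps: Taylor expansions and exhaustion -/

section

open Polynomial

namespace ValTower

section Immediate

variable {F E Γ : Type*} [Field F] [Field E] [Algebra F E] [LinearOrderedCommGroupWithZero Γ]
  {v : Valuation E Γ}

theorem val_aeval_sub_coeff_taylor_lt {g : F[X]} {a : E} {c : F} {B : Γ} (hB : 0 < B)
    (h : ∀ i, 0 < i →
      v (algebraMap F E ((taylor c g).coeff i)) * v (a - algebraMap F E c) ^ i < B) :
    v (aeval a g - algebraMap F E ((taylor c g).coeff 0)) < B := by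
  rw [aeval_eq_aeval_sub_taylor g a c, ← aeval_C (a - algebraMap F E c) (coeff _ _), ← map_sub]
  refine val_aeval_lt hB fun i => ?_
  rcases Nat.eq_zero_or_pos i with rfl | hi
  · simpa using hB
  · rw [coeff_sub, coeff_C_of_ne_zero hi.ne', sub_zero]
    exact h i hi

theorem val_aeval_sub_coeff_taylor_le {g : F[X]} {a : E} {c : F} {B : Γ}
    (h : ∀ i, 0 < i →
      v (algebraMap F E ((taylor c g).coeff i)) * v (a - algebraMap F E c) ^ i ≤ B) :
    v (aeval a g - algebraMap F E ((taylor c g).coeff 0)) ≤ B := by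
  rw [aeval_eq_aeval_sub_taylor g a c, ← aeval_C (a - algebraMap F E c) (coeff _ _), ← map_sub]
  refine val_aeval_le fun i => ?_
  rcases Nat.eq_zero_or_pos i with rfl | hi
  · simp
  · rw [coeff_sub, coeff_C_of_ne_zero hi.ne', sub_zero]
    exact h i hi

variable [FiniteDimensional F E] [IsGalois F E]

/-- When `c ∈ F` is sufficiently close to `a`, the constant term dominates in the Taylor expansion
at `c` of a polynomial of degree less than `[E : F]`. -/
theorem exists_taylor_lt (hq : (Module.finrank F E).Prime)
    (hv : ∀ (σ : E ≃ₐ[F] E) (x : E), v (σ x) = v x)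
    (hval : ∀ x : E, ∃ c : F, v x = v (algebraMap F E c))
    {a : E} (hrange : a ∉ Set.range (algebraMap F E))
    (hmin : ∀ c : F, ∃ d : F, v (a - algebraMap F E d) < v (a - algebraMap F E c)) :
    ∀ n, n < Module.finrank F E → ∀ g : F[X], g.natDegree ≤ n → g ≠ 0 →
      ∃ c₀ : F, ∀ c : F, v (a - algebraMap F E c) ≤ v (a - algebraMap F E c₀) → ∀ i, 0 < i →
        v (algebraMap F E ((taylor c g).coeff i)) * v (a - algebraMap F E c) ^ i <
          v (aeval a g) := by
  have hnat : ∀ i : ℕ, 0 < i → i < Module.finrank F E → v (i : E) = 1 := fun i hi0 hi =>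
    val_natCast_eq_one (val_natCast_finrank_lt_one hv hmin)
      (Nat.coprime_of_lt_prime hi0.ne' hi hq).symm
  have hpos : ∀ c : F, 0 < v (a - algebraMap F E c) := fun c => by
    obtain ⟨d, hd⟩ := hmin c
    exact zero_le.trans_lt hd
  -- The factor `i + 1` is a unit below the degree of the extension, and beyond it both coefficients
  -- vanish.
  have hcoeff : ∀ (g : F[X]) (c : F) (i : ℕ), g.natDegree < Module.finrank F E →
      v (algebraMap F E ((taylor c (derivative g)).coeff i)) =
        v (algebraMap F E ((taylor c g).coeff (i + 1))) := by
    intro g c i hg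
    rw [coeff_taylor_derivative, map_mul, map_mul]
    by_cases hi : i + 1 < Module.finrank F E
    · have := hnat (i + 1) (by omega) hi
      push_cast at this
      rw [map_add, map_natCast, map_one, this, mul_one]
    · rw [coeff_eq_zero_of_natDegree_lt (by rw [natDegree_taylor]; omega)]
      simp
  intro n
  induction n with
  | zero =>
    intro _ g hg hg0
    refine ⟨0, fun c _ i hi => ?_⟩
    rw [coeff_eq_zero_of_natDegree_lt (by rw [natDegree_taylor]; omega), map_zero, map_zero,
      zero_mul, zero_lt_iff, Valuation.ne_zero_iff]
    exact aeval_ne_zero_of_finrank_prime hq hrange (by omega) hg0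
  | succ n ih =>
    intro hn g hg hg0
    by_cases hd : derivative g = 0
    · refine ⟨0, fun c _ i hi => ?_⟩
      obtain ⟨i, rfl⟩ := Nat.exists_eq_add_of_lt hi
      rw [zero_add, ← hcoeff g c i (by omega), hd]
      simp only [map_zero, coeff_zero, zero_mul]
      rw [zero_lt_iff, Valuation.ne_zero_iff]
      exact aeval_ne_zero_of_finrank_prime hq hrange (by omega) hg0
    -- Induction on the derivative: near `a` the linear coefficient of `g` has constant value `β`,
    -- and all nonconstant terms are at most `β * v (a - c)`.
    obtain ⟨c₁, hc₁⟩ := ih (by omega) (derivative g)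
      ((natDegree_derivative_le g).trans (by omega)) hd
    set β := v (aeval a (derivative g)) with hβ
    have hβ0 : 0 < β := by
      rw [zero_lt_iff, hβ, Valuation.ne_zero_iff]
      exact aeval_ne_zero_of_finrank_prime hq hrange
        ((natDegree_derivative_le g).trans_lt (by omega)) hd
    have hhigh : ∀ c : F, v (a - algebraMap F E c) ≤ v (a - algebraMap F E c₁) → ∀ i, 0 < i →
        v (algebraMap F E ((taylor c g).coeff (i + 1))) * v (a - algebraMap F E c) ^ i < β := by
      intro c hc i hi
      rw [← hcoeff g c i (by omega)]
      exact hc₁ c hc i hi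
    have hone : ∀ c : F, v (a - algebraMap F E c) ≤ v (a - algebraMap F E c₁) →
        v (algebraMap F E ((taylor c g).coeff 1)) = β := by
      intro c hc
      rw [← zero_add 1, ← hcoeff g c 0 (by omega)]
      refine v.map_eq_of_sub_lt ?_
      rw [v.map_sub_swap]
      exact val_aeval_sub_coeff_taylor_lt hβ0 (hc₁ c hc)
    have hle : ∀ c : F, v (a - algebraMap F E c) ≤ v (a - algebraMap F E c₁) → ∀ i, 0 < i →
        v (algebraMap F E ((taylor c g).coeff i)) * v (a - algebraMap F E c) ^ i ≤
          β * v (a - algebraMap F E c) := by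
      intro c hc i hi
      obtain ⟨i, rfl⟩ := Nat.exists_eq_add_of_lt hi
      rw [zero_add, pow_succ, ← mul_assoc]
      refine mul_le_mul_left ?_ _
      rcases Nat.eq_zero_or_pos i with rfl | hi
      · rw [zero_add, pow_zero, mul_one, hone c hc]
      · exact (hhigh c hc i hi).le
    suffices h : ∃ c : F, v (a - algebraMap F E c) ≤ v (a - algebraMap F E c₁) ∧
        β * v (a - algebraMap F E c) < v (aeval a g) by
      obtain ⟨c, hc, hcβ⟩ := h
      refine ⟨c, fun d hdc i hi => (hle d (hdc.trans hc) i hi).trans_lt ?_⟩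
      exact (mul_le_mul_right hdc _).trans_lt hcβ
    by_contra! hcon
    -- normalize so that `c₁ = 0`
    obtain ⟨d, hd₁⟩ := hval (a - algebraMap F E c₁)
    obtain ⟨e, he⟩ := hval (aeval a (derivative g) * (a - algebraMap F E c₁))
    rw [map_mul, ← hβ] at he
    have hd0 : algebraMap F E d ≠ 0 := by
      rw [← Valuation.ne_zero_iff v, ← hd₁]
      exact (hpos c₁).ne'
    have he0 : algebraMap F E e ≠ 0 := by
      rw [← Valuation.ne_zero_iff v, ← he]
      exact (mul_pos hβ0 (hpos c₁)).ne'
    have hvd : 0 < v (algebraMap F E d) := hd₁ ▸ hpos c₁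
    have hve : 0 < v (algebraMap F E e) := he ▸ mul_pos hβ0 (hpos c₁)
    set b := (a - algebraMap F E c₁) / algebraMap F E d with hb
    have hbc : ∀ c : F, v (b - algebraMap F E c) =
        v (a - algebraMap F E (c₁ + d * c)) / v (algebraMap F E d) := by
      intro c
      rw [← map_div₀, hb]
      congr 1
      rw [map_add, map_mul]
      field_simp
      ring
    set h := C e⁻¹ * (taylor c₁ g).comp (C d * X) with hh
    have haeval : aeval b h = (algebraMap F E e)⁻¹ * aeval a g := by
      rw [hh, map_mul, aeval_C, aeval_comp, map_mul, aeval_C, aeval_X, hb, mul_div_cancel₀ _ hd0,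
        ← aeval_eq_aeval_sub_taylor, map_inv₀]
    have htail : ∀ c : F, v (b - algebraMap F E c) ≤ 1 →
        v (a - algebraMap F E (c₁ + d * c)) ≤ v (a - algebraMap F E c₁) := by
      intro c hc
      rwa [hbc, div_le_one₀ hvd, ← hd₁] at hc
    -- Dividing by `e`, of value `β * v (a - c₁)`, makes `h` integral with unit derivative at each
    -- nearby `c`; `hcon` becomes `v (h(b)) ≤ v (b - c)`.
    refine not_isRoot_approx (v := v) hq hv (a := b) (g := h) ?_ ?_ ?_ ?_ ?_ ?_
    · rw [hb, map_div₀, hd₁, div_self hvd.ne']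
    · intro c
      obtain ⟨k, hk⟩ := hmin (c₁ + d * c)
      refine ⟨(k - c₁) / d, ?_⟩
      have hd0' : d ≠ 0 := by
        rintro rfl
        simp at hd0
      rw [hbc, hbc, mul_div_cancel₀ _ hd0', add_sub_cancel]
      exact div_lt_div_of_pos_right hk hvd
    · refine lt_of_le_of_lt ((natDegree_C_mul_le _ _).trans (natDegree_comp_le.trans ?_)) hn
      rw [natDegree_taylor]
      exact (Nat.mul_le_mul hg ((natDegree_C_mul_le d X).trans natDegree_X_le)).trans (by simp)
    · intro i
      rw [hh, coeff_C_mul, comp_C_mul_X_coeff, map_mul, map_mul, map_mul, map_mul, map_pow, map_pow,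
        map_inv₀, map_inv₀, ← he, ← hd₁]
      refine inv_mul_le_one_of_le₀ ?_ zero_le
      rcases Nat.eq_zero_or_pos i with rfl | hi
      · rw [pow_zero, mul_one]
        have h1 := v.map_sub_le (hcon c₁ le_rfl) (val_aeval_sub_coeff_taylor_le (hle c₁ le_rfl))
        rwa [sub_sub_cancel] at h1
      · exact hle c₁ le_rfl i hi
    · intro c hc
      have h1 : (taylor c h).coeff 1 = e⁻¹ * (d * (taylor (c₁ + d * c) g).coeff 1) := by
        rw [taylor_coeff_one, taylor_coeff_one, hh, derivative_C_mul, derivative_comp,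
          taylor_apply, derivative_comp]
        simp [add_comm]
      rw [h1, map_mul, map_mul, map_mul, map_mul, hone _ (htail c hc), map_inv₀, map_inv₀, ← he,
        ← hd₁, mul_comm (v _) β, inv_mul_cancel₀ (mul_pos hβ0 (hpos c₁)).ne']
    · intro c hc
      rw [haeval, map_mul, map_inv₀, ← he, hbc, ← hd₁]
      rw [le_div_iff₀ (hpos c₁), mul_inv, mul_assoc, mul_assoc, inv_mul_le_iff₀ hβ0,
        mul_comm (v (aeval a g)), inv_mul_cancel_left₀ (hpos c₁).ne']
      exact hcon _ (htail c hc)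

/-- The immediate case. -/
theorem IsExhaustedByMonogenic.of_immediate (hq : (Module.finrank F E).Prime)
    (hv : ∀ (σ : E ≃ₐ[F] E) (x : E), v (σ x) = v x)
    (hval : ∀ x : E, ∃ c : F, v x = v (algebraMap F E c))
    (hmin : ∀ a : E, a ∉ Set.range (algebraMap F E) →
      ∀ c : F, ∃ d : F, v (a - algebraMap F E d) < v (a - algebraMap F E c)) :
    IsExhaustedByMonogenic F v := by
  obtain ⟨a, ha⟩ : ∃ a : E, a ∉ Set.range (algebraMap F E) := by
    by_contra! hcon
    refine hq.one_lt.ne' (finrank_eq_one_iff_of_nonzero' (1 : E) one_ne_zero |>.2 fun y => ?_)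
    obtain ⟨c, hc⟩ := hcon y
    exact ⟨c, by rw [Algebra.smul_def, mul_one, hc]⟩
  have hmin := hmin a ha
  have hpos : ∀ c : F, 0 < v (a - algebraMap F E c) := fun c => by
    obtain ⟨d, hd⟩ := hmin c
    exact zero_le.trans_lt hd
  choose d hd using fun c : F => hval (a - algebraMap F E c)
  have hd0 : ∀ c, algebraMap F E (d c) ≠ 0 := fun c => by
    rw [← Valuation.ne_zero_iff v, ← hd]
    exact (hpos c).ne'
  refine IsExhaustedByMonogenic.of_family v (ι := F)
    -- The order is reversed so that later members of the family are closer to `a`.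
    (fun c => OrderDual.toDual (v (a - algebraMap F E c)))
    (fun c => (a - algebraMap F E c) / algebraMap F E (d c)) (fun c => ?_) fun y hy => ?_
  · rw [map_div₀, hd, div_self ((Valuation.ne_zero_iff v).2 (hd0 c))]
  obtain ⟨g, hg, rfl⟩ := exists_aeval_eq_of_finrank_prime hq ha y
  rcases eq_or_ne g 0 with rfl | hg0
  · exact ⟨0, fun _ _ => ⟨0, by simp, by simp⟩⟩
  obtain ⟨c₀, hc₀⟩ := exists_taylor_lt hq hv hval ha hmin _ hg g le_rfl hg0
  refine ⟨c₀, fun c hc => ⟨(taylor c g).comp (C (d c) * X), fun i => ?_, ?_⟩⟩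
  · rw [comp_C_mul_X_coeff, map_mul, map_mul, map_pow, map_pow, ← hd]
    rcases Nat.eq_zero_or_pos i with rfl | hi
    · rw [pow_zero, mul_one]
      have hyne : 0 < v (aeval a g) := zero_lt_iff.2 ((Valuation.ne_zero_iff v).2
        (aeval_ne_zero_of_finrank_prime hq ha hg hg0))
      have h1 := val_aeval_sub_coeff_taylor_lt hyne (hc₀ c hc)
      rw [v.map_sub_swap] at h1
      rwa [v.map_eq_of_sub_lt h1]
    · exact (hc₀ c hc i hi).le.trans hy
  · rw [aeval_comp, map_mul, aeval_C, aeval_X, mul_div_cancel₀ _ (hd0 c),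
      ← aeval_eq_aeval_sub_taylor]

/-- The valuation ring of a Galois extension of prime degree with invariant valuation is exhausted
by monogenic algebras. -/
theorem IsExhaustedByMonogenic.of_isGaloisOfPrimeDegree (hq : (Module.finrank F E).Prime)
    (hv : ∀ (σ : E ≃ₐ[F] E) (x : E), v (σ x) = v x) : IsExhaustedByMonogenic F v := by
  by_cases hram : ∃ a : E, ∀ c : F, v a ≠ v (algebraMap F E c)
  · exact .of_ramified hq hv hram
  push Not at hram
  by_cases hres : ∃ a : E, v a ≤ 1 ∧ ∀ c : F, 1 ≤ v (a - algebraMap F E c)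
  · obtain ⟨a, ha, ha'⟩ := hres
    exact .of_residue v hq hv ha ha'
  push Not at hres
  refine .of_immediate hq hv hram fun a ha c => ?_
  -- Scaled by `d`, the difference `a - c` is a unit whose residue comes from some `k` in `F`; then
  -- `c + d * k` is closer to `a`.
  obtain ⟨d, hd⟩ := hram (a - algebraMap F E c)
  have hd0 : algebraMap F E d ≠ 0 := by
    rw [← Valuation.ne_zero_iff v, ← hd, Valuation.ne_zero_iff, sub_ne_zero]
    exact fun h => ha ⟨c, h.symm⟩
  have hvd : 0 < v (algebraMap F E d) := zero_lt_iff.2 ((Valuation.ne_zero_iff v).2 hd0)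
  obtain ⟨k, hk⟩ := hres ((a - algebraMap F E c) / algebraMap F E d) (by
    rw [map_div₀, hd, div_self hvd.ne'])
  refine ⟨c + d * k, ?_⟩
  have h1 : a - algebraMap F E (c + d * k) =
      ((a - algebraMap F E c) / algebraMap F E d - algebraMap F E k) * algebraMap F E d := by
    rw [map_add, map_mul]
    field_simp
    ring
  rw [h1, map_mul, hd]
  exact mul_lt_of_lt_one_left hvd hk

end Immediate

end ValTower

end

/-! ### Unibranched extensions and invariance of the valuation -/

section

open Polynomial

namespace ValTower

section Unibranched

variable {K L Γ : Type*} [Field K] [Field L] [Algebra K L] [LinearOrderedCommGroupWithZero Γ]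

/-- Chevalley's extension theorem; since `V → W` is local, nothing outside `V` becomes integral. -/
theorem exists_valuationSubring_comap_eq {E L : Type*} [Field E] [Field L] [Algebra E L]
    (V : ValuationSubring E) : ∃ W : ValuationSubring L, W.comap (algebraMap E L) = V := by
  obtain ⟨W, hW, hloc⟩ := IsLocalRing.exists_factor_valuationRing
    ((algebraMap E L).comp V.subtype)
  refine ⟨W, SetLike.ext fun x => ?_⟩
  rw [ValuationSubring.mem_comap]
  refine ⟨fun hx => ?_, fun hx => hW ⟨x, hx⟩⟩
  rcases V.mem_or_inv_mem x with h | h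
  · exact h
  rcases eq_or_ne x 0 with rfl | hx0
  · exact zero_mem V
  have hu : IsUnit (⟨x⁻¹, h⟩ : V) := hloc.map_nonunit _ <| isUnit_iff_exists_inv.2
    ⟨⟨algebraMap E L x, hx⟩, Subtype.ext (by
      change algebraMap E L x⁻¹ * algebraMap E L x = 1
      rw [← map_mul, inv_mul_cancel₀ hx0, map_one])⟩
  obtain ⟨y, hy⟩ := isUnit_iff_exists_inv.1 hu
  have hy' : x⁻¹ * (y : E) = 1 := congrArg Subtype.val hy
  rw [(inv_mul_eq_one₀ hx0).1 hy']
  exact y.2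

/-- In a unibranched extension, automorphisms of intermediate extensions preserve the valuation. -/
theorem IsUnibranched.val_algEquiv {ν : Valuation L Γ} (hν : IsUnibranched K ν)
    {F E : Type*} [Field F] [Field E] [Algebra K F] [Algebra K E] [Algebra F E] [Algebra E L]
    [IsScalarTower K F E] [IsScalarTower K E L] [FiniteDimensional F E] (σ : E ≃ₐ[F] E) (x : E) :
    ν (algebraMap E L (σ x)) = ν (algebraMap E L x) := by
  have hle : ∀ (σ : E ≃ₐ[F] E) (x : E),
      ν (algebraMap E L (σ x)) ≤ 1 ↔ ν (algebraMap E L x) ≤ 1 := by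
    intro σ x
    -- An extension to `L` of the `σ`-conjugate valuation ring agrees with `ν` on `K`, so
    -- unibranchedness identifies it with that of `ν`.
    obtain ⟨W, hW⟩ := exists_valuationSubring_comap_eq (L := L)
      ((valRing ν E).comap (σ : E →+* E))
    have hmem : ∀ y : E, algebraMap E L y ∈ W ↔ ν (algebraMap E L (σ y)) ≤ 1 := fun y => by
      rw [← ValuationSubring.mem_comap, hW]
      rfl
    have heq := hν _ W.valuation (Valuation.isEquiv_of_val_le_one fun c => by
      rw [Valuation.comap_apply, Valuation.comap_apply, ValuationSubring.valuation_le_one_iff,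
        IsScalarTower.algebraMap_apply K E L, hmem, IsScalarTower.algebraMap_apply K F E,
        σ.commutes])
    rw [← hmem, ← W.valuation_le_one_iff, heq.le_one_iff_le_one]
  have heq : ∀ σ : E ≃ₐ[F] E, ((ν.comap (algebraMap E L)).comap (σ : E →+* E)).IsEquiv
      (ν.comap (algebraMap E L)) := fun σ => Valuation.isEquiv_of_val_le_one (hle σ)
  have hlt : ∀ (σ : E ≃ₐ[F] E) (x : E),
      ¬ ν (algebraMap E L x) < ν (algebraMap E L (σ x)) := by
    intro σ x h
    have hn : ∀ n : ℕ, ν (algebraMap E L x) < ν (algebraMap E L ((σ ^ (n + 1)) x)) := by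
      intro n
      induction n with
      | zero => simpa using h
      | succ n ih =>
        have h1 := (heq σ).lt_iff_lt.2 ih
        rw [pow_succ' σ (n + 1), AlgEquiv.mul_apply]
        exact h.trans h1
    -- Equivalence gives equality of values because `σ` has finite order: a strict increase,
    -- iterated, would return to the start.
    have h1 := hn (orderOf σ - 1)
    rw [Nat.sub_add_cancel (orderOf_pos σ), pow_orderOf_eq_one] at h1
    exact lt_irrefl _ h1
  refine le_antisymm (not_lt.1 (hlt σ x)) ?_
  have h1 := not_lt.1 (hlt σ⁻¹ (σ x))
  rwa [← AlgEquiv.mul_apply, inv_mul_cancel, AlgEquiv.one_apply] at h1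

end Unibranched

/-! ### Cotangent homology of valuation rings and inertial steps -/

section Cotangent

variable {L Γ : Type*} [Field L] [LinearOrderedCommGroupWithZero Γ]
  (ν : Valuation L Γ) {F E : Type*} [Field F] [Field E] [Algebra F L] [Algebra E L]
  [Algebra F E] [IsScalarTower F E L]

/-- Divisibility by the minimal polynomial descends from `F` to its valuation ring because the
polynomial is monic with integral coefficients. -/
theorem subsingleton_h1Cotangent_valRing [Algebra.IsSeparable F E]
    (h : ∀ s : Finset E, (∀ y ∈ s, ν (algebraMap E L y) ≤ 1) → ∃ b : E, ν (algebraMap E L b) ≤ 1 ∧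
      (∀ i, ν (algebraMap F L ((minpoly F b).coeff i)) ≤ 1) ∧
      ∀ y ∈ s, IsIntegralPolynomialIn F (ν.comap (algebraMap E L)) b y) :
    Subsingleton (Algebra.H1Cotangent (valRing ν F) (valRing ν E)) := by
  classical
  refine Algebra.subsingleton_h1Cotangent_of_monogenic fun s => ?_
  obtain ⟨b, hb, hmin, hs⟩ := h (s.map ⟨_, Subtype.val_injective⟩) (by
    intro y hy
    obtain ⟨z, -, rfl⟩ := Finset.mem_map.1 hy
    exact z.2)
  have hinj : Function.Injective (valRing ν F).subtype := Subtype.val_injective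
  refine ⟨⟨b, hb⟩, fun y hy => ?_, ?_⟩
  · obtain ⟨g, hg, hgy⟩ := hs y (Finset.mem_map_of_mem _ hy)
    obtain ⟨P, rfl, -⟩ := exists_map_subtype_eq ν (F := F) (g := g) fun i => by
      rw [IsScalarTower.algebraMap_apply F E L]
      exact hg i
    exact ⟨P, Subtype.ext ((coe_aeval_valRing ν _ P).trans hgy)⟩
  · obtain ⟨f, hf, -⟩ := exists_map_subtype_eq ν hmin
    have hfm : f.Monic := by
      have h1 := minpoly.monic (A := F) (x := b) (Algebra.IsSeparable.isIntegral F b)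
      rw [← hf] at h1
      exact monic_of_injective hinj h1
    refine ⟨f, Subtype.ext ?_, fun h0 => ?_, fun u hu => ?_⟩
    · rw [coe_aeval_valRing, hf]
      exact minpoly.aeval F b
    · have h1 := congrArg Subtype.val h0
      rw [coe_aeval_valRing, ← derivative_map, hf] at h1
      exact (Algebra.IsSeparable.isSeparable F b).aeval_derivative_ne_zero (minpoly.aeval F b) h1
    · have h1 := congrArg Subtype.val hu
      rw [coe_aeval_valRing] at h1
      rw [← map_dvd_map _ hinj hfm, hf]
      exact minpoly.dvd F b h1

theorem subsingleton_h1Cotangent_of_isGaloisOfPrimeDegree [FiniteDimensional F E]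
    (hFE : IsGaloisOfPrimeDegree F E)
    (hv : ∀ (σ : E ≃ₐ[F] E) (x : E), ν (algebraMap E L (σ x)) = ν (algebraMap E L x)) :
    Subsingleton (Algebra.H1Cotangent (valRing ν F) (valRing ν E)) := by
  have := hFE.1
  refine subsingleton_h1Cotangent_valRing ν fun s hs => ?_
  obtain ⟨b, hb, hbs⟩ := IsExhaustedByMonogenic.of_isGaloisOfPrimeDegree
    (v := ν.comap (algebraMap E L)) hFE.2 hv s hs
  refine ⟨b, hb, fun i => ?_, hbs⟩
  rw [IsScalarTower.algebraMap_apply F E L]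
  exact val_coeff_minpoly_le_one (ν.comap (algebraMap E L)) hv hb i

theorem subsingleton_h1Cotangent_of_isInertialStep [FiniteDimensional F E]
    (hFE : IsInertialStep ν F E) :
    Subsingleton (Algebra.H1Cotangent (valRing ν F) (valRing ν E)) := by
  obtain ⟨hfin, hsep⟩ := hFE
  set n := Module.finrank F E with hn
  have hn0 : 0 < n := Module.finrank_pos
  have : FiniteDimensional (resField ν F) (resField ν E) :=
    Module.finite_of_finrank_pos (hfin ▸ hn0)
  obtain ⟨α, hα⟩ := Field.exists_primitive_element (resField ν F) (resField ν E)
  have hdeg : (minpoly (resField ν F) α).natDegree = n := by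
    rw [hfin, ← IntermediateField.finrank_top', ← hα,
      IntermediateField.adjoin.finrank (Algebra.IsIntegral.isIntegral α)]
  obtain ⟨a, rfl⟩ := IsLocalRing.residue_surjective α
  set v := ν.comap (algebraMap E L) with hv
  have hva : ∀ c : F, v (algebraMap F E c) = ν (algebraMap F L c) := fun c => by
    rw [IsScalarTower.algebraMap_apply F E L]
    rfl
  have hunit : ∀ g : F[X], g.natDegree < n → (∀ i, v (algebraMap F E (g.coeff i)) ≤ 1) →
      (∃ i, v (algebraMap F E (g.coeff i)) = 1) → v (aeval (a : E) g) = 1 := by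
    intro g hg hg1 hgu
    simp only [hva] at hg1 hgu
    obtain ⟨G, rfl, hG⟩ := exists_map_subtype_eq ν hg1
    rw [← coe_aeval_valRing]
    by_contra hne
    have hlt : ν (algebraMap E L (aeval a G : valRing ν E)) < 1 :=
      lt_of_le_of_ne (aeval a G : valRing ν E).2 hne
    rw [← residue_valRing_eq_zero_iff, ← aeval_residue_map] at hlt
    have hGne : G.map (IsLocalRing.residue (valRing ν F)) ≠ 0 := by
      intro h0
      obtain ⟨i, hi⟩ := hgu
      have h1 : IsLocalRing.residue (valRing ν F) (G.coeff i) = 0 := by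
        rw [← coeff_map, h0, coeff_zero]
      rw [residue_valRing_eq_zero_iff] at h1
      rw [coeff_map] at hi
      exact h1.ne hi
    have h1 := (natDegree_le_of_dvd (minpoly.dvd _ _ hlt) hGne).trans natDegree_map_le
    exact absurd (h1.trans_lt (hG ▸ hg)) (not_lt.2 hdeg.ge)
  have hcoeff : ∀ g : F[X], g.natDegree < n → ∀ i,
      v (algebraMap F E (g.coeff i)) ≤ v (aeval (a : E) g) :=
    fun g hg i => val_coeff_le_val_aeval v hunit hg i
  have hint : IsIntegral F (a : E) := Algebra.IsIntegral.isIntegral _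
  -- A monic polynomial of smaller degree cannot vanish at `a`, since its value there bounds that of
  -- its leading coefficient.
  have hmindeg : (minpoly F (a : E)).natDegree = n := by
    refine le_antisymm (minpoly.natDegree_le _) ?_
    by_contra! hlt
    have h1 := hcoeff _ hlt (minpoly F (a : E)).natDegree
    rw [minpoly.aeval, (minpoly.monic hint).coeff_natDegree, map_one, map_one, map_zero] at h1
    exact absurd h1 (not_le.2 zero_lt_one)
  have ha1 : v (a : E) ≤ 1 := a.2
  have hmin1 : ∀ i, ν (algebraMap F L ((minpoly F (a : E)).coeff i)) ≤ 1 := by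
    intro i
    -- This difference takes the integral value `a ^ n` at `a`, so its coefficients are integral.
    have hlt : (X ^ n - minpoly F (a : E)).natDegree < n := by
      rcases eq_or_ne (X ^ n - minpoly F (a : E)) 0 with h0 | h0
      · rwa [h0, natDegree_zero]
      have h1 := natDegree_lt_natDegree h0 (degree_sub_lt_left (p := X ^ n) (q := minpoly F (a : E))
        (by rw [degree_X_pow, degree_eq_natDegree (minpoly.ne_zero hint), hmindeg])
        (monic_X_pow n).ne_zero
        (by rw [(monic_X_pow n).leadingCoeff, (minpoly.monic hint).leadingCoeff]))
      rwa [natDegree_X_pow] at h1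
    have h1 : v (algebraMap F E ((X ^ n - minpoly F (a : E)).coeff i)) ≤ 1 := by
      refine (hcoeff _ hlt i).trans ?_
      rw [map_sub, minpoly.aeval, sub_zero, map_pow, aeval_X, map_pow]
      exact pow_le_one' ha1 n
    have h2 : v (algebraMap F E ((X ^ n : F[X]).coeff i)) ≤ 1 := by
      rw [coeff_X_pow]
      split_ifs <;> simp
    have h3 := v.map_sub_le h2 h1
    rwa [← map_sub, ← coeff_sub, sub_sub_cancel, hva] at h3
  have hsepa : IsSeparable F (a : E) := by
    obtain ⟨f, hf, hfdeg⟩ := exists_map_subtype_eq ν hmin1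
    have hfm : f.Monic := by
      have h1 := minpoly.monic hint
      rw [← hf] at h1
      exact monic_of_injective Subtype.val_injective h1
    have hf0 : aeval a f = 0 := Subtype.ext (by
      rw [coe_aeval_valRing, hf]
      exact minpoly.aeval F (a : E))
    -- Separability lifts from the residue extension: the minimal polynomial of `a` reduces to that
    -- of its residue, so its derivative is nonzero.
    have hfres : f.map (IsLocalRing.residue (valRing ν F)) =
        minpoly (resField ν F) (IsLocalRing.residue (valRing ν E) a) := by
      refine eq_of_monic_of_dvd_of_natDegree_le
        (minpoly.monic (Algebra.IsIntegral.isIntegral _)) (hfm.map _) (minpoly.dvd _ _ ?_) ?_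
      · rw [aeval_residue_map, hf0, map_zero]
      · rw [hfm.natDegree_map, hfdeg, hmindeg, hdeg]
    refine (separable_iff_derivative_ne_zero (minpoly.irreducible hint)).2 fun h0 => ?_
    rw [← hf, derivative_map, ← Polynomial.map_zero (valRing ν F).subtype] at h0
    have h1 : derivative f = 0 := map_injective _ Subtype.val_injective h0
    refine (Algebra.IsSeparable.isSeparable (resField ν F)
      (IsLocalRing.residue (valRing ν E) a)).aeval_derivative_ne_zero
        (minpoly.aeval (resField ν F) (IsLocalRing.residue (valRing ν E) a)) ?_
    rw [← hfres, derivative_map, h1, Polynomial.map_zero, map_zero]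
  have hsepE : Algebra.IsSeparable F E := by
    have h1 := (IntermediateField.isSeparable_adjoin_simple_iff_isSeparable F E).2 hsepa
    rw [(Field.primitive_element_iff_minpoly_natDegree_eq F (a : E)).2 hmindeg] at h1
    exact AlgEquiv.Algebra.isSeparable IntermediateField.topEquiv
  refine subsingleton_h1Cotangent_valRing ν fun s hs => ⟨a, a.2, hmin1, fun y hy => ?_⟩
  obtain ⟨g, hg, rfl⟩ := exists_aeval_eq_of_natDegree_minpoly hmindeg y
  exact ⟨g, fun i => (hcoeff g hg i).trans (hs _ hy), rfl⟩

end Cotangent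

end ValTower

end

/-! ### The exact sequence for each step -/

open ValTower in
theorem mainTheorem5 {K : Type u} {L : Type v} {Γ : Type w} [Field K] [Field L] [Algebra K L]
    [FiniteDimensional K L] [LinearOrderedCommGroupWithZero Γ] (ν : Valuation L Γ)
    (hν : ValTower.IsUnibranched K ν)
    (ℓ : ℕ) (T : Fin (ℓ + 1) → IntermediateField K L)
    (hbot : T 0 = ⊥) (htop : T (Fin.last ℓ) = ⊤)
    (hle : ∀ i : Fin ℓ, T i.castSucc ≤ T i.succ)
    (hstep : ∀ i : Fin ℓ,
      ValTower.IsGaloisOfPrimeDegree (T i.castSucc) (IntermediateField.extendScalars (hle i)) ∨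
      ValTower.IsInertialStep ν (T i.castSucc) (IntermediateField.extendScalars (hle i))) :
    ∀ i : Fin ℓ,
      ValTower.KaehlerShortExact ν (T i.castSucc) (IntermediateField.extendScalars (hle i)) K := by
  intro i
  have hfin : FiniteDimensional (T i.castSucc) (IntermediateField.extendScalars (hle i)) :=
    inferInstance
  have : Subsingleton (Algebra.H1Cotangent (valRing ν (T i.castSucc))
      (valRing ν (IntermediateField.extendScalars (hle i)))) := by
    rcases hstep i with h | h
    · exact subsingleton_h1Cotangent_of_isGaloisOfPrimeDegree ν h (hν.val_algEquiv)
    · exact subsingleton_h1Cotangent_of_isInertialStep ν h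
  exact ⟨KaehlerDifferential.mapBaseChange_injective_of_subsingleton_h1Cotangent _ _ _,
    KaehlerDifferential.exact_mapBaseChange_map _ _ _,
    KaehlerDifferential.map_surjective _ _ _⟩
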